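/- **Setting.** Let $n\ge 1$, $X\subseteq\mathbb R^n$ (Euclidean norm), action set $\{0,1\}$, horizon $T$. A mentor has a fixed policy $\pi^m:X\to\{0,1\}$ belonging to a class $\Pi$ of policies. In each round $t=1,\dots,T$ an adaptive, randomized adversary (who may use everything that happened in earlier rounds) produces an input $x_t\in X$ and a payoff function $\mu_t:X\times\{0,1\}\to[0,1]$; the agent then either takes an action $y_t\in\{0,1\}$ and earns $\mu_t(x_t,y_t)$, or queries the mentor, learns $\pi^m(x_t)$, and earns $\mu_t(x_t,\pi^m(x_t))$. Payoffs are never observed. Write $\mu_t^m(x)=\mu_t(x,\pi^m(x))$. Assume *local generalization* with constant $L>0$, $|\mu_t^m(x)-\mu_t(x,\pi^m(x'))|\le L\|x-x'\|$ for all $x,x'\in X$ and all $t$, and $\mu^m_t(x_t)\ge\mu_{\min}>0$ always. With $a_t$ the agent's payoff in round $t$, let $$R^{+}_T=\sum_t\mu_t^m(x_t)-\sum_t a_t,\qquad R^{\times}_T=\log\prod_t\mu_t^m(x_t)-\log\prod_t a_t\quad(=\infty\text{ if some }a_t=0),$$ and let $Q_T$ be the set of rounds with a query. Expectations are over the randomness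 of both the agent and the adversary. **Learnability.** Let $d\ge1$. One of the following holds. 1. $\Pi$ consists of measurable policies and has VC dimension $d$, and the inputs are $\sigma$-smooth with respect to a reference probability distribution $U$ on $X$ (for instance the uniform one): in each round the adversary chooses, depending on earlier rounds, a distribution $D_t$ with $D_t(S)\le U(S)/\sigma$ for all measurable $S$, and $x_t\sim D_t$. 2. $\Pi$ has Littlestone dimension $d$ and the inputs are arbitrary; in this case put $\sigma=1$. **Covers.** An *expert* predicts an action from the current input and the past inputs; a policy is an expert that ignores the past. A smooth $\varepsilon$-cover of $\Pi$ is a finite set of measurable policies such that for each $\pi\in\Pi$ some member $\tilde\pi$ has $U(\tilde\pi\ne\pi)\le\varepsilon$. An adversarial cover of $\Pi$ is a finite set of experts such that for each $\pi\in\Pi$ and each input sequence of length $T$ some member agrees with $\pi$ in all $T$ rounds. **Algorithm.** Let $\varepsilon=T^{-2n/(2n+1)}$, $p=1/\sqrt{\varepsilon T}$, and let $\tilde\Pi$ be, in case 1, a smooth $\varepsilon$-cover of $\Pi$ of size at most $(41/\varepsilon)^d$, and in case 2, an adversarial cover of size at most $(eT/d)^d$. Let $\eta=\max\bigl(\sqrt{p\log|\tilde\Pi|/(2T)},\,p^2/\sqrt2\bigr)$.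 Initially all weights $w(\pi)$, $\pi\in\tilde\Pi$, are $1$ and $S=\emptyset$. In round $t$, with probability $p$ (independently of everything before) make a *Hedge query*: query the mentor, let $\ell(\pi)\in\{0,1\}$ indicate whether the prediction of $\pi$ for $x_t$ differs from $\pi^m(x_t)$, and update $w(\pi)\gets w(\pi)\exp\bigl(-\eta\,(\ell(\pi)-\min_{\pi'}\ell(\pi'))/p\bigr)$ for all $\pi\in\tilde\Pi$. Otherwise sample $\pi_t\in\tilde\Pi$ with probability proportional to $w$, and let $b$ be its prediction for $x_t$; query the mentor if $\|x_t-x\|>\varepsilon^{1/n}$ for every $(x,y)\in S$ with $y=b$ (in particular if there is none), and take action $b$ if not. After every query add $(x_t,\pi^m(x_t))$ to $S$. **Theorem.** Such covers exist: in case 1 for every $T\ge 1$, and in case 2 for every $T\ge d$. There is a constant $C>0$ depending only on $n$ such that for every $T\ge2$, every such cover, and every mentor with $\pi^m\in\Pi$ and every adversary as above, $$\mathbb E[R^{+}_T]\le C\,\frac{dL}{\sigma}\,T^{-1/(2n+1)}\log T,\qquad \mathbb E|Q_T|\le C\,T^{\frac{4n+1}{4n+2}}\Bigl(\frac d\sigma\log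 T+\mathbb E\bigl[\operatorname{diam}(\{x_1,\dots,x_T\})^n\bigr]\Bigr),$$ and, if moreover $T$ is so large that $\varepsilon\le(\mu_{\min}/(2L))^n$, $$\mathbb E[R^{\times}_T]\le C\,\frac{dL}{\sigma\mu_{\min}}\,T^{-1/(2n+1)}\log T .$$ Consequently, for fixed $n,d,\sigma,L,\mu_{\min}$ and $K$, and every $\delta>0$, there is $T_0$ such that for all $T\ge T_0$, in every such setting, $\mathbb E[R^\times_T]\le\delta$, $\mathbb E[R^+_T]\le\delta$, and, provided $\mathbb E[\operatorname{diam}(\{x_1,\dots,x_T\})^n]\le K$, also $\mathbb E|Q_T|\le\delta T$. -/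

import Mathlib

open MeasureTheory
open scoped ENNReal

noncomputable section

namespace AskForHelp

/-! ### Policy classes, VC dimension, Littlestone dimension, covers.
The action set is `{0,1}`, represented by `Bool`. -/

/-- The class `𝒞` of policies `X → {0,1}` shatters the finite set `s`: it realizes every
labelling of `s`. -/
def Shatters {X : Type*} (𝒞 : Set (X → Bool)) (s : Finset X) : Prop :=
  ∀ f : X → Bool, ∃ π ∈ 𝒞, ∀ x ∈ s, π x = f x

/-- The VC dimension of `𝒞` is exactly `d` (in particular finite). -/
def HasVCDim {X : Type*} (𝒞 : Set (X → Bool)) (d : ℕ) : Prop :=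
  (∃ s : Finset X, s.card = d ∧ Shatters 𝒞 s) ∧ ∀ s : Finset X, Shatters 𝒞 s → s.card ≤ d

/-- A complete binary tree whose internal nodes carry points of `X` is a map `List Bool → X`: the
node reached from the root by the left/right path `l` carries `tree l`.
The tree of depth `k` is shattered by `𝒞` if the labels along each root-to-leaf path `b` are
realized by some policy of `𝒞` on the nodes of that path. -/
def TreeShattered {X : Type*} (𝒞 : Set (X → Bool)) (k : ℕ) (tree : List Bool → X) : Prop :=
  ∀ b : List Bool, b.length = k →
    ∃ π ∈ 𝒞, ∀ (i : ℕ) (hi : i < b.length), π (tree (b.take i)) = b[i]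

/-- The Littlestone dimension of `𝒞` is exactly `d` (in particular finite). -/
def HasLittlestoneDim {X : Type*} (𝒞 : Set (X → Bool)) (d : ℕ) : Prop :=
  (∃ tree, TreeShattered 𝒞 d tree) ∧ ∀ k, (∃ tree, TreeShattered 𝒞 k tree) → k ≤ d

/-- An expert. It may use the inputs of the earlier rounds: `e past x` is its prediction for the
current input `x` when the earlier inputs are `past`, listed with the most recent one first. -/
abbrev Expert (X : Type*) := List X → X → Bool

/-- A policy, as an expert that ignores the past. -/
def policyExpert {X : Type*} (π : X → Bool) : Expert X := fun _ x => π x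

/-- `Q 0, …, Q (N-1)` is a smooth `ε`-cover of `𝒞` with respect to the distribution `U`. -/
def IsSmoothCover {X : Type*} [MeasurableSpace X] (U : Measure X) (ε : ℝ) (𝒞 : Set (X → Bool))
    {N : ℕ} (Q : Fin N → X → Bool) : Prop :=
  (∀ i, Measurable (Q i)) ∧ ∀ π ∈ 𝒞, ∃ i, U {x | Q i x ≠ π x} ≤ ENNReal.ofReal ε

/-- `E 0, …, E (N-1)` is an adversarial cover of `𝒞` for horizon `T`: for each input sequence of
length `T` and each `π ∈ 𝒞`, one of the experts agrees with `π` in all `T` rounds.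
(`xs` has the most recent input first, so its suffixes `x :: past` are the situations of
the successive rounds.) -/
def IsAdversarialCover {X : Type*} (T : ℕ) (𝒞 : Set (X → Bool)) {N : ℕ}
    (E : Fin N → Expert X) : Prop :=
  ∀ π ∈ 𝒞, ∀ xs : List X, xs.length = T →
    ∃ i, ∀ (x : X) (past : List X), (x :: past) <:+ xs → E i past x = π x

/-! ### The algorithm -/

/-- The agent's own random choice in one round. `none`: the coin `hedgeQuery` came up `true`.
`some i`: it came up `false` and the `i`-th expert of the cover was sampled. -/
abbrev Outcome (N : ℕ) := Option (Fin N)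

/-- The parameters with which the algorithm runs: the cover, the query probability `p`, the
learning rate `η`, and the radius beyond which an input counts as unfamiliar. -/
structure Params (X : Type*) (N : ℕ) where
  expert : Fin N → Expert X
  p : ℝ
  η : ℝ
  radius : ℝ

/-- The algorithm for horizon `T`, accuracy `ε`, input space in `ℝⁿ`, and cover `E`. -/
def algorithm {X : Type*} {N : ℕ} (n T : ℕ) (ε : ℝ) (E : Fin N → Expert X) : Params X N where
  expert := E
  p := 1 / √(ε * T)
  η := max (√(1 / √(ε * T) * Real.log N / (2 * T))) ((1 / √(ε * T)) ^ 2 / √2)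
  radius := ε ^ (1 / (n : ℝ))

/-- The internal state of the agent: the weights, the set of past queried inputs with the mentor's
answers, and the past inputs (most recent first). -/
structure AgentState (X : Type*) (N : ℕ) where
  w : Fin N → ℝ
  S : Set (X × Bool)
  past : List X

/-- The initial state. -/
def AgentState.init (X : Type*) (N : ℕ) : AgentState X N := ⟨fun _ => 1, ∅, []⟩

/-- The probability of each random choice of the agent in state `s`: it queries with probability
`p`, and otherwise samples an expert with probability proportional to its weight. -/
def choiceProb {X : Type*} {N : ℕ} (A : Params X N) (s : AgentState X N) : Outcome N → ℝ≥0∞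
  | none => ENNReal.ofReal A.p
  | some i => ENNReal.ofReal ((1 - A.p) * (s.w i / ∑ j, s.w j))

open Classical in
/-- The action in state `s` on input `x`; `none` means that the mentor is queried. If the coin does
not ask for a query, the agent follows the sampled expert, unless each past queried input
on which the mentor took the action that this expert proposes is farther from `x` than `radius`. -/
def action {X : Type*} [PseudoMetricSpace X] {N : ℕ} (A : Params X N) (s : AgentState X N) (x : X) :
    Outcome N → Option Bool
  | none => none
  | some i =>
      if ∀ z ∈ s.S, z.2 = A.expert i s.past x → A.radius < dist x z.1 then none
      else some (A.expert i s.past x)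

/-- The `0`-`1` loss of the `i`-th expert in state `s` on input `x` when the mentor's action is
`m`. -/
def loss {X : Type*} {N : ℕ} (A : Params X N) (s : AgentState X N) (x : X) (m : Bool)
    (i : Fin N) : ℝ :=
  if A.expert i s.past x = m then 0 else 1

/-- The state after a round with input `x` and random choice `o`, where `m` is the mentor's action
on `x`, which is used in rounds with a query only. The weights are updated in the rounds with
`hedgeQuery = true`, by the Hedge rule for the importance-weighted loss `(ℓ - min ℓ) / p`. -/
def nextState {X : Type*} [PseudoMetricSpace X] {N : ℕ} (A : Params X N) (s : AgentState X N)
    (x : X) (m : Bool) (o : Outcome N) : AgentState X N where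
  w := match o with
    | none => fun i => s.w i * Real.exp (-A.η * ((loss A s x m i - ⨅ j, loss A s x m j) / A.p))
    | some _ => s.w
  S := match action A s x o with
    | none => insert (x, m) s.S
    | some _ => s.S
  past := x :: s.past

/-! ### The environment -/

/-- A mentor together with an adaptive randomized adversary, for horizon `T`.
`Ω` is the sample space of the adversary's own randomization. Histories `h` list the agent's random
choices of the earlier rounds (most recent first), so that `h.length` is the number of earlier
rounds, and everything that happened earlier is determined by `ω` and `h`. In the round after
history `h` the input is `input ω h` and the payoff function is `payoff ω h`. -/
structure Environment (X : Type*) [PseudoMetricSpace X] [MeasurableSpace X] (N : ℕ) (Ω : Type*)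
    [MeasurableSpace Ω] (T : ℕ) (L μmin : ℝ) where
  mentor : X → Bool
  input : Ω → List (Outcome N) → X
  payoff : Ω → List (Outcome N) → X → Bool → ℝ
  measurable_input : ∀ h, h.length < T → Measurable fun ω => input ω h
  measurable_payoff : ∀ h, h.length < T →
    (∀ y, Measurable fun ω => payoff ω h (input ω h) y) ∧
      Measurable fun ω => payoff ω h (input ω h) (mentor (input ω h))
  payoff_mem : ∀ ω h, h.length < T → ∀ x y, payoff ω h x y ∈ Set.Icc (0 : ℝ) 1
  /-- local generalization with constant `L` -/
  local_generalization : ∀ ω h, h.length < T → ∀ x x',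
    |payoff ω h x (mentor x) - payoff ω h x (mentor x')| ≤ L * dist x x'
  /-- the mentor's payoff is always at least `μmin` -/
  mentor_payoff : ∀ ω h, h.length < T → μmin ≤ payoff ω h (input ω h) (mentor (input ω h))

/-- A distribution `D` is `σ`-smooth with respect to `U`. -/
def IsSmooth {X : Type*} [MeasurableSpace X] (U : Measure X) (σ : ℝ) (D : Measure X) : Prop :=
  ∀ S, MeasurableSet S → D S ≤ U S / ENNReal.ofReal σ

section Run

variable {X : Type*} [PseudoMetricSpace X] [MeasurableSpace X] {N : ℕ} {Ω : Type*}
  [MeasurableSpace Ω] {T : ℕ} {L μmin : ℝ}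

/-- The input sequence is `σ`-smooth with respect to `U`: in each round the adversary chooses a
`σ`-smooth distribution `D h ω` depending on the earlier rounds (`𝓕 t` is what the adversary's
randomization has revealed before round `t + 1`), and the input is sampled from it. -/
def SmoothInputs (P : Measure Ω) (U : Measure X) (σ : ℝ) (G : Environment X N Ω T L μmin) : Prop :=
  ∃ (𝓕 : Filtration ℕ ‹MeasurableSpace Ω›) (D : List (Outcome N) → Ω → Measure X),
    ∀ h, h.length < T →
      Measurable[𝓕 h.length] (D h) ∧
      (∀ ω, IsProbabilityMeasure (D h ω) ∧ IsSmooth U σ (D h ω)) ∧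
      Measurable[𝓕 (h.length + 1)] (fun ω => G.input ω h) ∧
      ∀ B, MeasurableSet[𝓕 h.length] B → ∀ S, MeasurableSet S →
        P (B ∩ {ω | G.input ω h ∈ S}) = ∫⁻ ω in B, D h ω S ∂P

/-- The state of the agent after history `h`. -/
def stateAfter (A : Params X N) (G : Environment X N Ω T L μmin) (ω : Ω) :
    List (Outcome N) → AgentState X N
  | [] => AgentState.init X N
  | o :: h => nextState A (stateAfter A G ω h) (G.input ω h) (G.mentor (G.input ω h)) o

/-- The agent's action (`none` = query) in the round after history `h`, if its choice is `o`. -/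
def actionAt (A : Params X N) (G : Environment X N Ω T L μmin) (ω : Ω) (h : List (Outcome N))
    (o : Outcome N) : Option Bool :=
  action A (stateAfter A G ω h) (G.input ω h) o

/-- The inputs during the history. -/
def inputs (G : Environment X N Ω T L μmin) (ω : Ω) : List (Outcome N) → List X
  | [] => []
  | _ :: h => G.input ω h :: inputs G ω h

/-- The mentor's payoffs in the rounds of the history. -/
def mentorPayoffs (G : Environment X N Ω T L μmin) (ω : Ω) : List (Outcome N) → List ℝ
  | [] => []
  | _ :: h => G.payoff ω h (G.input ω h) (G.mentor (G.input ω h)) :: mentorPayoffs G ω h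

/-- The agent's payoffs in the rounds of the history; a query earns the mentor's payoff. -/
def agentPayoffs (A : Params X N) (G : Environment X N Ω T L μmin) (ω : Ω) :
    List (Outcome N) → List ℝ
  | [] => []
  | o :: h => G.payoff ω h (G.input ω h) ((actionAt A G ω h o).getD (G.mentor (G.input ω h))) ::
      agentPayoffs A G ω h

/-- The number of rounds of the history in which the mentor was queried. -/
def numQueries (A : Params X N) (G : Environment X N Ω T L μmin) (ω : Ω) :
    List (Outcome N) → ℕ
  | [] => 0
  | o :: h => (if actionAt A G ω h o = none then 1 else 0) + numQueries A G ω h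

/-- The additive regret. -/
def addRegret (A : Params X N) (G : Environment X N Ω T L μmin) (ω : Ω)
    (h : List (Outcome N)) : ℝ :=
  (mentorPayoffs G ω h).sum - (agentPayoffs A G ω h).sum

open Classical in
/-- The multiplicative regret, which is `∞` if one of the agent's payoffs vanishes. -/
def mulRegret (A : Params X N) (G : Environment X N Ω T L μmin) (ω : Ω)
    (h : List (Outcome N)) : EReal :=
  if (0 : ℝ) ∈ agentPayoffs A G ω h then ⊤
  else ((Real.log (mentorPayoffs G ω h).prod - Real.log (agentPayoffs A G ω h).prod : ℝ) : EReal)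

/-- The `n`-th power of the diameter of the set of inputs. -/
def diamPow (n : ℕ) (G : Environment X N Ω T L μmin) (ω : Ω) (h : List (Outcome N)) : ℝ≥0∞ :=
  ENNReal.ofReal (Metric.diam {x | x ∈ inputs G ω h} ^ n)

/-- The expectation of `f` over the agent's choices in `k` further rounds after history `h`, for a
fixed `ω`: the agent's randomization is fresh in each round, and is independent of the adversary's.
-/
def agentMean (A : Params X N) (G : Environment X N Ω T L μmin) (ω : Ω)
    (f : List (Outcome N) → ℝ≥0∞) : ℕ → List (Outcome N) → ℝ≥0∞
  | 0, h => f h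
  | k + 1, h => ∑ o : Outcome N, choiceProb A (stateAfter A G ω h) o * agentMean A G ω f k (o :: h)

/-- The expectation, over all randomness, of a `[0,∞]`-valued function of the run of `T` rounds. -/
def expectNN (A : Params X N) (G : Environment X N Ω T L μmin) (P : Measure Ω)
    (f : Ω → List (Outcome N) → ℝ≥0∞) : ℝ≥0∞ :=
  ∫⁻ ω, agentMean A G ω (f ω) T [] ∂P

/-- The expectation of an extended real function: that of its positive part minus that of its
negative part. -/
def expectation (A : Params X N) (G : Environment X N Ω T L μmin) (P : Measure Ω)
    (f : Ω → List (Outcome N) → EReal) : EReal :=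
  (expectNN A G P (fun ω h => (f ω h).toENNReal) : EReal) -
    (expectNN A G P (fun ω h => (-f ω h).toENNReal) : EReal)

/-- First learnability condition: `𝒞` is a class of (measurable) policies of VC dimension `d`, the
inputs are `σ`-smooth, and the experts are a smooth `ε`-cover of `𝒞` of size at most `(41/ε)^d`. -/
def SmoothVCCase (P : Measure Ω) (𝒞 : Set (X → Bool)) (d : ℕ) (σ ε : ℝ) (E : Fin N → Expert X)
    (G : Environment X N Ω T L μmin) : Prop :=
  HasVCDim 𝒞 d ∧ (∀ π ∈ 𝒞, Measurable π) ∧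
    ∃ U : Measure X, IsProbabilityMeasure U ∧ SmoothInputs P U σ G ∧
      ∃ Q : Fin N → X → Bool, IsSmoothCover U ε 𝒞 Q ∧ (N : ℝ) ≤ (41 / ε) ^ d ∧
        E = fun i => policyExpert (Q i)

end Run

/-- Second learnability condition: `𝒞` has Littlestone dimension `d`, and the experts are an
adversarial cover of `𝒞` of size at most `(eT/d)^d`. The inputs are arbitrary. -/
def LittlestoneCase {X : Type*} (T : ℕ) (𝒞 : Set (X → Bool)) (d : ℕ) {N : ℕ}
    (E : Fin N → Expert X) : Prop :=
  HasLittlestoneDim 𝒞 d ∧ IsAdversarialCover T 𝒞 E ∧ (N : ℝ) ≤ (Real.exp 1 * T / d) ^ d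

/-- The accuracy `ε = T^(-2n/(2n+1))`. -/
def accuracy (n T : ℕ) : ℝ := (T : ℝ) ^ (-(2 * n : ℝ) / (2 * n + 1))

end AskForHelp

end

open AskForHelp

/-!
The theorem combines a count of wrong samples with an estimate of what each of them costs. Call a
round a wrong sample if the agent samples an expert whose prediction differs from the mentor's
action.

*Costs.* If the agent acts on a wrong sample, then the action was the mentor's on an input within
`ε ^ (1 / n)`, so by local generalization the round costs at most `L ε ^ (1 / n)`; all other rounds
cost nothing (`addRegret_le`, `mulRegret_le`). A query is a Hedge query, or a wrong sample, or else
it adds to `S` an input farther than `ε ^ (1 / n)` from all the earlier ones with the same label.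
The inputs of the last kind are separated, and there are at most `O(1 + diam ^ n / ε)` of them by a
grid argument (`numQueries_le`).

*Wrong samples.* For fixed adversarial randomness, Hedge with importance weights is analysed by a
supermartingale (`hedgePotential`): the expected number of wrong samples is at most
`(2 / η) log N` if some expert is right throughout, and at most that plus twice the expected loss of
any fixed expert in general. In the Littlestone case the first bound applies, with an expert that
depends on the run. In the smooth case the second one applies to an expert at `U`-distance at most
`ε` from the mentor, whose expected loss is at most `T ε / σ`, because the probability of a history
is determined by what the adversary has revealed before the round
(`lintegral_mul_agentMean_totalLoss_le`). Since `η ≥ p² / √2` and `p² = 1 / (ε T)`, both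
bounds are `O((d / σ) ε T log T)` (`exists_majorant_wrongSamples`). The first-order analysis needs
`η ≤ p`; if that fails, then `log N` is so large that the trivial bound `T` is good enough.

*Covers.* A smooth cover is a maximal `ε`-separated subset, and its size is bounded by Haussler's
packing lemma (`card_le_of_separated`), which gives `(41 / ε) ^ d` without a logarithmic factor. An
adversarial cover is constructed by induction on the horizon
(`exists_adversarialCover_of_not_treeShattered`).
-/

namespace AskForHelp

/-! ### Combinatorics of set families of bounded VC dimension -/

theorem sum_choose_le_pow {d m : ℕ} (hd : 1 ≤ d) (hm : d ≤ m) :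
    ((∑ k ∈ Finset.range (d + 1), m.choose k : ℕ) : ℝ) ≤ (Real.exp 1 * m / d) ^ d := by
  have hd0 : (0 : ℝ) < d := by exact_mod_cast hd
  have hm0 : (0 : ℝ) < m := by exact_mod_cast hd.trans hm
  set x : ℝ := d / m with hx
  have hx0 : 0 < x := by positivity
  have hx1 : x ≤ 1 := by
    rw [hx, div_le_one hm0]; exact_mod_cast hm
  have h1 : ((∑ k ∈ Finset.range (d + 1), m.choose k : ℕ) : ℝ) * x ^ d ≤ Real.exp d := by
    calc ((∑ k ∈ Finset.range (d + 1), m.choose k : ℕ) : ℝ) * x ^ d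
        = ∑ k ∈ Finset.range (d + 1), x ^ d * (m.choose k : ℝ) := by
          push_cast; rw [Finset.sum_mul]; exact Finset.sum_congr rfl fun _ _ => mul_comm _ _
      _ ≤ ∑ k ∈ Finset.range (d + 1), x ^ k * (m.choose k : ℝ) := by
          refine Finset.sum_le_sum fun k hk => mul_le_mul_of_nonneg_right ?_ (by positivity)
          exact pow_le_pow_of_le_one hx0.le hx1 (by simpa [Nat.lt_succ_iff] using hk)
      _ ≤ ∑ k ∈ Finset.range (m + 1), x ^ k * (m.choose k : ℝ) := by
          refine Finset.sum_le_sum_of_subset_of_nonneg ?_ fun _ _ _ => by positivity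
          exact Finset.range_mono (by omega)
      _ = (x + 1) ^ m := by rw [add_pow]; simp
      _ ≤ (Real.exp x) ^ m := by gcongr; exact Real.add_one_le_exp x
      _ = Real.exp d := by
          rw [← Real.exp_nat_mul]; congr 1; rw [hx]; field_simp
  calc ((∑ k ∈ Finset.range (d + 1), m.choose k : ℕ) : ℝ) ≤ Real.exp d / x ^ d := by
        rwa [le_div_iff₀ (by positivity)]
    _ = (Real.exp 1 * m / d) ^ d := by
        rw [hx, ← mul_one (d : ℝ), Real.exp_nat_mul, mul_one, ← div_pow]; congr 1; field_simp

open Finset in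
/-- The one-inclusion graph of a set family, whose edges join sets that differ in a single element,
has at most `d` edges per vertex if `d` bounds the VC dimension. -/
theorem sum_card_edges_le {α : Type*} [DecidableEq α] (u : Finset α) :
    ∀ (𝒜 : Finset (Finset α)) (d : ℕ), 𝒜 ⊆ u.powerset → (∀ s, 𝒜.Shatters s → #s ≤ d) →
      ∑ a ∈ u, #{A ∈ 𝒜 | a ∉ A ∧ insert a A ∈ 𝒜} ≤ d * #𝒜 := by
  induction u using Finset.induction_on with
  | empty => intro 𝒜 d _ _; simp
  | insert b u hb ih =>
    -- With `𝒩` the members of `𝒜` without `b`, and `ℳ` those with `b`, from which `b` is removed,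
    -- the edges in direction `b` correspond to `𝒩 ∩ ℳ`, whose VC dimension is at most `d - 1`, and
    -- the other edges are counted in `𝒩 ∪ ℳ` and `𝒩 ∩ ℳ`.
    intro 𝒜 d h𝒜 hd
    set 𝒩 := 𝒜.nonMemberSubfamily b with h𝒩
    set ℳ := 𝒜.memberSubfamily b with hℳ
    have mN : ∀ s, s ∈ 𝒩 ↔ s ∈ 𝒜 ∧ b ∉ s := fun s => by rw [h𝒩, mem_nonMemberSubfamily]
    have mM : ∀ s, s ∈ ℳ ↔ insert b s ∈ 𝒜 ∧ b ∉ s := fun s => by rw [hℳ, mem_memberSubfamily]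
    have hsub : 𝒩 ∪ ℳ ⊆ u.powerset := by
      intro s hs
      rw [mem_powerset]
      intro x hx
      rcases mem_union.1 hs with h | h
      · have := mem_powerset.1 (h𝒜 ((mN s).1 h).1) hx
        exact (mem_insert.1 this).resolve_left fun e => ((mN s).1 h).2 (e ▸ hx)
      · have := mem_powerset.1 (h𝒜 ((mM s).1 h).1) (mem_insert_of_mem hx)
        exact (mem_insert.1 this).resolve_left fun e => ((mM s).1 h).2 (e ▸ hx)
    have hvc1 : ∀ s, (𝒩 ∪ ℳ).Shatters s → #s ≤ d := by
      intro s hs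
      have hbs : b ∉ s := by
        intro hbs
        obtain ⟨t, ht, hst⟩ := hs (Subset.refl s)
        have : b ∈ t := (mem_inter.1 (hst.symm ▸ hbs : b ∈ s ∩ t)).2
        rcases mem_union.1 ht with h | h
        · exact ((mN t).1 h).2 this
        · exact ((mM t).1 h).2 this
      refine hd s fun t ht => ?_
      obtain ⟨v, hv, hsv⟩ := hs ht
      rcases mem_union.1 hv with h | h
      · exact ⟨v, ((mN v).1 h).1, hsv⟩
      · exact ⟨insert b v, ((mM v).1 h).1, by rw [inter_insert_of_notMem hbs, hsv]⟩
    have hvc2 : ∀ s, (𝒩 ∩ ℳ).Shatters s → #s + 1 ≤ d := by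
      intro s hs
      have hbs : b ∉ s := by
        intro hbs
        obtain ⟨t, ht, hst⟩ := hs (Subset.refl s)
        exact ((mN t).1 (mem_inter.1 ht).1).2 (mem_inter.1 (hst.symm ▸ hbs : b ∈ s ∩ t)).2
      rw [← card_insert_of_notMem hbs]
      refine hd _ fun t ht => ?_
      obtain ⟨v, hv, hsv⟩ := hs (t := t.erase b) (by
        rwa [← subset_insert_iff])
      obtain ⟨hv1, hv2⟩ := mem_inter.1 hv
      by_cases hbt : b ∈ t
      · refine ⟨insert b v, ((mM v).1 hv2).1, ?_⟩
        rw [← insert_inter_distrib, hsv, insert_erase hbt]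
      · refine ⟨v, ((mN v).1 hv1).1, ?_⟩
        rw [insert_inter_of_notMem ((mN v).1 hv1).2, hsv, erase_eq_of_notMem hbt]
    have hcard : #𝒜 = #(𝒩 ∪ ℳ) + #(𝒩 ∩ ℳ) := by
      rw [card_union_add_card_inter, add_comm, hℳ, h𝒩,
        card_memberSubfamily_add_card_nonMemberSubfamily]
    have hedge_b : #{A ∈ 𝒜 | b ∉ A ∧ insert b A ∈ 𝒜} = #(𝒩 ∩ ℳ) := by
      congr 1
      ext s
      simp only [mem_filter, mem_inter, mN, mM]
      tauto
    have hedge : ∀ a ∈ u, #{A ∈ 𝒜 | a ∉ A ∧ insert a A ∈ 𝒜} ≤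
        #{A ∈ 𝒩 ∪ ℳ | a ∉ A ∧ insert a A ∈ 𝒩 ∪ ℳ} +
          #{A ∈ 𝒩 ∩ ℳ | a ∉ A ∧ insert a A ∈ 𝒩 ∩ ℳ} := by
      intro a ha
      have hab : a ≠ b := fun e => hb (e ▸ ha)
      have e1 : #{A ∈ 𝒜 | a ∉ A ∧ insert a A ∈ 𝒜} =
          #{A ∈ ℳ | a ∉ A ∧ insert a A ∈ ℳ} + #{A ∈ 𝒩 | a ∉ A ∧ insert a A ∈ 𝒩} := by
        rw [← card_memberSubfamily_add_card_nonMemberSubfamily b]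
        congr 2
        · ext s
          simp only [mem_filter, mem_memberSubfamily, mM, mem_insert, not_or,
            Finset.insert_comm a b]
          constructor <;> intro h <;> simp_all [Ne.symm hab]
        · ext s
          simp only [mem_filter, mem_nonMemberSubfamily, mN, mem_insert, not_or]
          constructor <;> intro h <;> simp_all [Ne.symm hab]
      rw [e1, ← card_union_add_card_inter]
      refine Nat.add_le_add (card_le_card ?_) (card_le_card ?_)
      · intro s hs
        simp only [mem_filter, mem_union] at hs ⊢
        tauto
      · intro s hs
        simp only [mem_filter, mem_inter] at hs ⊢
        tauto
    rw [sum_insert hb, hedge_b]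
    have hsum := sum_le_sum hedge
    rw [sum_add_distrib] at hsum
    have h1 := ih (𝒩 ∪ ℳ) d hsub hvc1
    rcases Nat.eq_zero_or_pos d with rfl | hdpos
    · have h2 : 𝒩 ∩ ℳ = ∅ := by
        by_contra hne
        have := hvc2 ∅ (shatters_empty.2 (nonempty_iff_ne_empty.2 hne))
        omega
      rw [h2] at hsum ⊢
      simp only [filter_empty, card_empty, sum_const_zero, add_zero, zero_add] at hsum ⊢
      omega
    · obtain ⟨e, rfl⟩ : ∃ e, d = e + 1 := ⟨d - 1, by omega⟩
      have h2 := ih (𝒩 ∩ ℳ) e (inter_subset_union.trans hsub)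
        fun s hs => by have := hvc2 s hs; omega
      rw [hcard]
      nlinarith

open Finset in
/-- The weighted form of `sum_card_edges_le`, obtained by applying it to the families
`{A | t < w A}` and summing over `t`. -/
theorem sum_min_edges_le {α : Type*} [DecidableEq α] [Fintype α] (w : Finset α → ℕ) (d : ℕ)
    (hd : ∀ s, ({A | 0 < w A} : Finset (Finset α)).Shatters s → #s ≤ d) :
    ∑ a, ∑ A with a ∉ A, min (w A) (w (insert a A)) ≤ d * ∑ A, w A := by
  obtain ⟨M, hM⟩ : ∃ M, ∀ A, w A ≤ M := ⟨∑ A, w A, fun A => single_le_sum (by simp) (mem_univ A)⟩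
  have layer : ∀ v, v ≤ M → v = ∑ t ∈ range M, if t < v then 1 else 0 := by
    intro v hv
    rw [← card_filter]
    have : ({t ∈ range M | t < v} : Finset ℕ) = range v := by
      ext t; simp only [mem_filter, mem_range]; omega
    rw [this, card_range]
  calc ∑ a, ∑ A with a ∉ A, min (w A) (w (insert a A))
      = ∑ a, ∑ A with a ∉ A, ∑ t ∈ range M,
          if t < w A ∧ t < w (insert a A) then 1 else 0 := by
        refine sum_congr rfl fun a _ => sum_congr rfl fun A _ => ?_
        rw [layer (min _ _) ((min_le_left _ _).trans (hM A))]
        simp only [lt_min_iff]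
    _ = ∑ t ∈ range M, ∑ a, #{A ∈ ({A | t < w A} : Finset (Finset α)) |
          a ∉ A ∧ insert a A ∈ ({A | t < w A} : Finset (Finset α))} := by
        conv_rhs => rw [sum_comm]
        refine sum_congr rfl fun a _ => ?_
        rw [sum_comm]
        refine sum_congr rfl fun t _ => ?_
        rw [← card_filter]
        congr 1
        ext A
        simp only [mem_filter, mem_univ, true_and]
        tauto
    _ ≤ ∑ t ∈ range M, d * #{A | t < w A} := by
        refine sum_le_sum fun t _ => sum_card_edges_le univ _ d (by simp) fun s hs => hd s ?_
        refine hs.mono_left fun A hA => ?_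
        simp only [mem_filter, mem_univ, true_and] at hA ⊢
        omega
    _ = d * ∑ A, w A := by
        rw [← mul_sum]
        congr 1
        simp only [card_filter]
        rw [sum_comm]
        exact sum_congr rfl fun A _ => (layer _ (hM A)).symm

open Finset in
theorem card_le_sum_choose {α : Type*} [DecidableEq α] [Fintype α] (𝒜 : Finset (Finset α)) (d : ℕ)
    (hd : ∀ s, 𝒜.Shatters s → #s ≤ d) :
    #𝒜 ≤ ∑ k ∈ range (d + 1), (Fintype.card α).choose k := by
  refine (card_le_card_shatterer 𝒜).trans (card_shatterer_le_sum_vcDim.trans ?_)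
  refine sum_le_sum_of_subset fun k hk => ?_
  have : 𝒜.vcDim ≤ d := Finset.sup_le fun s hs => hd s (mem_shatterer.1 hs)
  simp only [mem_Iic, mem_range] at hk ⊢
  omega


/-! ### The packing lemma for classes of bounded VC dimension -/

open Finset in
/-- The set of indices `i` at which column `j` of the Boolean matrix `b` is `true`. -/
def column {s M : ℕ} (b : Fin s → Fin M → Bool) (j : Fin M) : Finset (Fin s) := {i | b i j = true}

theorem mem_column {s M : ℕ} {b : Fin s → Fin M → Bool} {j : Fin M} {i : Fin s} :
    i ∈ column b j ↔ b i j = true := by simp [column]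

open Finset in
/-- The number of columns of `b` that are equal to `A`. -/
def columnWeight {s M : ℕ} (b : Fin s → Fin M → Bool) (A : Finset (Fin s)) : ℕ :=
  #{j | column b j = A}

open Finset in
/-- The total weight of the edges in direction `a` of the one-inclusion graph of the columns of `b`.
An edge weighs as much as the lighter of its two ends. -/
def edgeWeight {s M : ℕ} (a : Fin s) (b : Fin s → Fin M → Bool) : ℕ :=
  ∑ A with a ∉ A, min (columnWeight b A) (columnWeight b (insert a A))

open Finset in
theorem sum_columnWeight {s M : ℕ} (b : Fin s → Fin M → Bool) : ∑ A, columnWeight b A = M := by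
  have := card_eq_sum_card_fiberwise (s := (univ : Finset (Fin M))) (t := univ)
    (f := column b) (by simp)
  simpa [columnWeight] using this.symm

theorem min_ge_mul_div_add {u v : ℝ} (hu : 0 ≤ u) (hv : 0 ≤ v) (h : 0 < u + v) :
    u * v / (u + v) ≤ min u v := by
  rw [div_le_iff₀ h]
  rcases le_total u v with h' | h'
  · rw [min_eq_left h']; nlinarith
  · rw [min_eq_right h']; nlinarith

open Finset in
/-- Replacing row `a` by `c` splits each class of columns that agree off row `a` into two parts, of
sizes `u` and `v`, and `min u v ≥ u v / (u + v)`. -/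
theorem edgeWeight_update_ge {s M : ℕ} (a : Fin s) (b : Fin s → Fin M → Bool) (c : Fin M → Bool) :
    ∑ A ∈ univ.image (fun j => (column b j).erase a),
      (∑ j with (column b j).erase a = A, ∑ j' with (column b j').erase a = A,
        if c j = false ∧ c j' = true then (1 : ℝ) else 0) / #{j | (column b j).erase a = A} ≤
    edgeWeight a (Function.update b a c) := by
  have hcol : ∀ j, (column (Function.update b a c) j).erase a = (column b j).erase a := by
    intro j
    ext i
    simp only [column, mem_erase, mem_filter, mem_univ, true_and]
    by_cases h : i = a
    · simp [h]
    · simp [h]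
  have hmem : ∀ j, a ∈ column (Function.update b a c) j ↔ c j = true := by
    intro j; simp [column]
  rw [edgeWeight]
  push_cast
  have hsub : univ.image (fun j => (column b j).erase a) ⊆
      ({A | a ∉ A} : Finset (Finset (Fin s))) := by
    intro A hA
    obtain ⟨j, _, rfl⟩ := mem_image.1 hA
    simp
  refine le_trans (sum_le_sum fun A hA => ?_)
    (sum_le_sum_of_subset_of_nonneg hsub fun _ _ _ => by positivity)
  have haA : a ∉ A := by simpa using hsub hA
  have e0 : columnWeight (Function.update b a c) A =
      #{j ∈ ({j | (column b j).erase a = A} : Finset (Fin M)) | c j = false} := by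
    rw [columnWeight]
    congr 1
    ext j
    simp only [mem_filter, mem_univ, true_and]
    rw [← hcol, ← Bool.not_eq_true, ← hmem]
    constructor
    · rintro h; rw [h]; exact ⟨erase_eq_of_notMem haA, haA⟩
    · rintro ⟨h1, h2⟩; rwa [erase_eq_of_notMem h2] at h1
  have e1 : columnWeight (Function.update b a c) (insert a A) =
      #{j ∈ ({j | (column b j).erase a = A} : Finset (Fin M)) | c j = true} := by
    rw [columnWeight]
    congr 1
    ext j
    simp only [mem_filter, mem_univ, true_and]
    rw [← hcol, ← hmem]
    constructor
    · rintro h; rw [h]; exact ⟨erase_insert haA, mem_insert_self _ _⟩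
    · rintro ⟨h1, h2⟩; rw [← h1, insert_erase h2]
  rw [e0, e1]
  generalize hcl : ({j | (column b j).erase a = A} : Finset (Fin M)) = cl
  have hne : 0 < #cl := by
    obtain ⟨j, _, hj⟩ := mem_image.1 hA
    exact card_pos.2 ⟨j, by rw [← hcl]; simp [hj]⟩
  have hadd : #{j ∈ cl | c j = false} + #{j ∈ cl | c j = true} = #cl := by
    have := card_filter_add_card_filter_not (s := cl) (fun j => c j = false)
    simpa using this
  have hprod : (∑ j ∈ cl, ∑ j' ∈ cl, if c j = false ∧ c j' = true then (1 : ℝ) else 0) =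
      #{j ∈ cl | c j = false} * #{j ∈ cl | c j = true} := by
    rw [card_filter, card_filter]
    push_cast
    rw [sum_mul_sum]
    refine sum_congr rfl fun j _ => sum_congr rfl fun j' _ => ?_
    by_cases h1 : c j = false <;> by_cases h2 : c j' = true <;> simp [h1, h2]
  rw [hprod]
  have hadd' : (#cl : ℝ) = #{j ∈ cl | c j = false} + #{j ∈ cl | c j = true} := by
    exact_mod_cast hadd.symm
  rw [hadd']
  refine min_ge_mul_div_add (by positivity) (by positivity) ?_
  rw [← hadd']
  exact_mod_cast hne

section Packing

variable {X : Type*} {𝒞 : Set (X → Bool)} {d M s : ℕ} {v : Fin M → X → Bool}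

open Finset in
/-- An index set shattered by traces of policies in `𝒞` on the points `x i` carries distinct points,
which form a set shattered by `𝒞`. -/
theorem card_le_of_shatters_traces (hd : ∀ s : Finset X, Shatters 𝒞 s → s.card ≤ d)
    (x : Fin s → X) (𝒦 : Finset (Finset (Fin s))) (I : Finset (Fin s)) (hI : 𝒦.Shatters I)
    (h𝒦 : ∀ A ∈ 𝒦, ∃ π ∈ 𝒞, ∀ i ∈ I, i ∈ A ↔ π (x i) = true) : #I ≤ d := by
  classical
  have hinj : Set.InjOn x I := by
    intro i hi i' hi' hii
    by_contra hne
    obtain ⟨A, hA, hIA⟩ := hI (t := {i}) (by simpa using hi)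
    obtain ⟨π, -, hπ⟩ := h𝒦 A hA
    have h1 : i ∈ A := (mem_inter.1 (hIA.symm ▸ mem_singleton_self i : i ∈ I ∩ A)).2
    have h2 : i' ∉ A := fun h => hne (mem_singleton.1 (hIA ▸ mem_inter.2 ⟨hi', h⟩)).symm
    rw [hπ i' hi', ← hii, ← hπ i hi] at h2
    exact h2 h1
  rw [← card_image_of_injOn hinj]
  refine hd _ fun f => ?_
  obtain ⟨A, hA, hIA⟩ := hI (t := {i ∈ I | f (x i) = true}) (filter_subset _ _)
  obtain ⟨π, hπ𝒞, hπ⟩ := h𝒦 A hA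
  refine ⟨π, hπ𝒞, fun y hy => ?_⟩
  obtain ⟨i, hi, rfl⟩ := mem_image.1 hy
  have : i ∈ I ∩ A ↔ i ∈ ({i ∈ I | f (x i) = true} : Finset (Fin s)) := by rw [hIA]
  simp only [mem_inter, mem_filter, hi, true_and, hπ i hi] at this
  exact Bool.eq_iff_iff.2 this

/-- The matrix of the values of the policies `v j` at the points `x i`. -/
def traceMatrix (v : Fin M → X → Bool) (x : Fin s → X) : Fin s → Fin M → Bool :=
  fun i j => v j (x i)

theorem sum_edgeWeight_le (hd : ∀ s : Finset X, Shatters 𝒞 s → s.card ≤ d)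
    (hv : ∀ j, v j ∈ 𝒞) (x : Fin s → X) :
    ∑ a, edgeWeight a (traceMatrix v x) ≤ d * M := by
  have := sum_min_edges_le (columnWeight (traceMatrix v x)) d ?_
  · rwa [sum_columnWeight] at this
  · refine fun I hI => card_le_of_shatters_traces hd x _ I hI fun A hA => ?_
    simp only [Finset.mem_filter, Finset.mem_univ, true_and, columnWeight, Finset.card_pos] at hA
    obtain ⟨j, hj⟩ := hA
    refine ⟨v j, hv j, fun i _ => ?_⟩
    simp only [Finset.mem_filter, Finset.mem_univ, true_and] at hj
    rw [← hj, mem_column, traceMatrix]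

open Finset in
theorem card_classes_le (hd : ∀ s : Finset X, Shatters 𝒞 s → s.card ≤ d)
    (hv : ∀ j, v j ∈ 𝒞) (x : Fin s → X) (a : Fin s) :
    #(univ.image (fun j => (column (traceMatrix v x) j).erase a)) ≤
      ∑ k ∈ range (d + 1), s.choose k := by
  have := card_le_sum_choose (univ.image (fun j => (column (traceMatrix v x) j).erase a)) d ?_
  · simpa using this
  · intro I hI
    have haI : a ∉ I := by
      intro ha
      obtain ⟨A, hA, hIA⟩ := hI (Subset.refl I)
      obtain ⟨j, -, rfl⟩ := mem_image.1 hA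
      have := (mem_inter.1 (hIA.symm ▸ ha : a ∈ I ∩ _)).2
      simp at this
    refine card_le_of_shatters_traces hd x _ I hI fun A hA => ?_
    obtain ⟨j, -, rfl⟩ := mem_image.1 hA
    refine ⟨v j, hv j, fun i hi => ?_⟩
    have : i ≠ a := fun e => haI (e ▸ hi)
    rw [mem_erase, mem_column, traceMatrix]
    exact and_iff_right this

end Packing

section Packing

variable {X : Type*} [MeasurableSpace X] {U : Measure X} {𝒞 : Set (X → Bool)} {d M s : ℕ}
  {v : Fin M → X → Bool} {ε : ℝ}

theorem measurable_edgeWeight (hm : ∀ j, Measurable (v j)) (a : Fin s) :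
    Measurable fun x : Fin s → X => (edgeWeight a (traceMatrix v x) : ℝ≥0∞) := by
  have h1 : Measurable fun x : Fin s → X => traceMatrix v x :=
    measurable_pi_lambda _ fun i => measurable_pi_lambda _ fun j =>
      (hm j).comp (measurable_pi_apply i)
  exact (measurable_of_finite fun b : Fin s → Fin M → Bool => (edgeWeight a b : ℝ≥0∞)).comp h1

open Finset in
/-- Resampling the point `x a` separates every two policies of a class with probability at least
`ε`. -/
theorem lintegral_edgeWeight_ge [IsProbabilityMeasure U]
    (hm : ∀ j, Measurable (v j))
    (hsep : ∀ i j, i ≠ j → ENNReal.ofReal ε ≤ U {x | v i x ≠ v j x}) (x : Fin s → X) (a : Fin s) :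
    ENNReal.ofReal (ε / 2 *
        (M - (#(univ.image (fun j => (column (traceMatrix v x) j).erase a)) : ℕ))) ≤
      ∫⁻ z, (edgeWeight a (traceMatrix v (Function.update x a z)) : ℝ≥0∞) ∂U := by
  set b := traceMatrix v x with hb
  set 𝒦 := univ.image (fun j => (column b j).erase a) with h𝒦
  have hupd : ∀ z, traceMatrix v (Function.update x a z) =
      Function.update b a (fun j => v j z) := by
    intro z
    funext i j
    by_cases h : i = a
    · subst h; simp [traceMatrix]
    · simp [traceMatrix, h, hb]
  set E : Fin M → Fin M → Set X := fun j j' => {z | v j z = false ∧ v j' z = true} with hE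
  have hEm : ∀ j j', MeasurableSet (E j j') := fun j j' =>
    (hm j (measurableSet_singleton false)).inter (hm j' (measurableSet_singleton true))
  have hint : ∀ j j',
      Integrable (fun z => if v j z = false ∧ v j' z = true then (1 : ℝ) else 0) U := by
    intro j j'
    have := (integrable_indicator_iff (μ := U) (f := fun _ => (1 : ℝ)) (hEm j j')).2
      (integrable_const 1).integrableOn
    refine this.congr (ae_of_all _ fun z => ?_)
    simp [Set.indicator, hE]
  have hval : ∀ j j', ∫ z, (if v j z = false ∧ v j' z = true then (1 : ℝ) else 0) ∂U =
      U.real (E j j') := by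
    intro j j'
    rw [← integral_indicator_one (hEm j j')]
    refine integral_congr_ae (ae_of_all _ fun z => ?_)
    simp [Set.indicator, hE]
  set g : X → ℝ := fun z => ∑ A ∈ 𝒦,
      (∑ j with (column b j).erase a = A, ∑ j' with (column b j').erase a = A,
        if v j z = false ∧ v j' z = true then (1 : ℝ) else 0) / #{j | (column b j).erase a = A}
    with hg
  have hgint : Integrable g U :=
    integrable_finsetSum _ fun A _ => (integrable_finsetSum _ fun j _ =>
      integrable_finsetSum _ fun j' _ => hint j j').div_const _
  have hgval : ∫ z, g z ∂U = ∑ A ∈ 𝒦,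
      (∑ j with (column b j).erase a = A, ∑ j' with (column b j').erase a = A,
        U.real (E j j')) / #{j | (column b j).erase a = A} := by
    rw [hg, integral_finsetSum _ fun A _ => (integrable_finsetSum _ fun j _ =>
      integrable_finsetSum _ fun j' _ => hint j j').div_const _]
    refine sum_congr rfl fun A _ => ?_
    rw [integral_div, integral_finsetSum _ fun j _ => integrable_finsetSum _ fun j' _ => hint j j']
    congr 1
    refine sum_congr rfl fun j _ => ?_
    rw [integral_finsetSum _ fun j' _ => hint j j']
    exact sum_congr rfl fun j' _ => hval j j'
  have hpair : ∀ j j', j ≠ j' → ε ≤ U.real (E j j') + U.real (E j' j) := by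
    intro j j' hne
    rw [← measureReal_union _ (hEm j' j)]
    · have h1 := hsep j j' hne
      rw [ENNReal.ofReal_le_iff_le_toReal (measure_ne_top _ _)] at h1
      refine h1.trans (ENNReal.toReal_mono (measure_ne_top _ _) (measure_mono ?_))
      intro z hz
      simp only [Set.mem_ofPred_eq] at hz
      simp only [hE, Set.mem_union, Set.mem_ofPred_eq]
      cases h : v j z <;> cases h' : v j' z
      · exact absurd (h.trans h'.symm) hz
      · exact Or.inl ⟨rfl, rfl⟩
      · exact Or.inr ⟨rfl, rfl⟩
      · exact absurd (h.trans h'.symm) hz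
    · rw [Set.disjoint_left]
      rintro z ⟨h1, -⟩ ⟨-, h4⟩
      exact Bool.false_ne_true (h1.symm.trans h4)
  have hclass : ∀ A ∈ 𝒦, ε / 2 * ((#{j | (column b j).erase a = A} : ℝ) - 1) ≤
      (∑ j with (column b j).erase a = A, ∑ j' with (column b j').erase a = A,
        U.real (E j j')) / #{j | (column b j).erase a = A} := by
    intro A hA
    generalize hcl : ({j | (column b j).erase a = A} : Finset (Fin M)) = cl
    have hne : 0 < #cl := by
      obtain ⟨j, _, hj⟩ := mem_image.1 hA
      exact card_pos.2 ⟨j, by rw [← hcl]; simp [hj]⟩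
    have hne' : (0 : ℝ) < #cl := by exact_mod_cast hne
    rw [le_div_iff₀ hne']
    have hsym : 2 * ∑ j ∈ cl, ∑ j' ∈ cl, U.real (E j j') =
        ∑ j ∈ cl, ∑ j' ∈ cl, (U.real (E j j') + U.real (E j' j)) := by
      simp only [sum_add_distrib]
      rw [two_mul]
      congr 1
      exact sum_comm
    have hlow : ∑ j ∈ cl, ∑ j' ∈ cl.erase j, ε ≤
        ∑ j ∈ cl, ∑ j' ∈ cl, (U.real (E j j') + U.real (E j' j)) := by
      refine sum_le_sum fun j hj => le_trans (sum_le_sum fun j' hj' => ?_)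
        (sum_le_sum_of_subset_of_nonneg (erase_subset j cl) fun _ _ _ => by positivity)
      exact hpair j j' (ne_of_mem_erase hj').symm
    have hcard : ∑ j ∈ cl, ∑ j' ∈ cl.erase j, ε = #cl * ((#cl - 1) * ε) := by
      rw [sum_congr rfl fun j hj => by rw [sum_const, card_erase_of_mem hj]]
      rw [sum_const, nsmul_eq_mul, nsmul_eq_mul, Nat.cast_sub hne, Nat.cast_one]
    rw [hcard, ← hsym] at hlow
    linarith
  have hM : (M : ℝ) = ∑ A ∈ 𝒦, (#{j | (column b j).erase a = A} : ℝ) := by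
    have := card_eq_sum_card_image (fun j => (column b j).erase a) (univ : Finset (Fin M))
    rw [card_univ, Fintype.card_fin] at this
    exact_mod_cast this
  have hlow : ε / 2 * (M - (#𝒦 : ℕ)) ≤ ∫ z, g z ∂U := by
    rw [hgval]
    refine le_trans (le_of_eq ?_) (sum_le_sum hclass)
    rw [← mul_sum, sum_sub_distrib, ← hM]
    simp
  refine (ENNReal.ofReal_le_ofReal hlow).trans ?_
  rw [ofReal_integral_eq_lintegral_ofReal hgint]
  · refine lintegral_mono fun z => ?_
    rw [hupd]
    refine (ENNReal.ofReal_le_ofReal (edgeWeight_update_ge a b fun j => v j z)).trans ?_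
    rw [ENNReal.ofReal_natCast]
  · refine ae_of_all _ fun z => ?_
    exact sum_nonneg fun A _ => div_nonneg (sum_nonneg fun j _ => sum_nonneg fun j' _ => by
      positivity) (by positivity)

/-- A lower bound for the average over one resampled coordinate, uniform in the other ones, bounds
the integral. -/
theorem lintegral_pi_ge [IsProbabilityMeasure U] {f : (Fin s → X) → ℝ≥0∞} (hf : Measurable f)
    (a : Fin s) {c : ℝ≥0∞} (h : ∀ x, c ≤ ∫⁻ z, f (Function.update x a z) ∂U) :
    c ≤ ∫⁻ x, f x ∂(Measure.pi fun _ => U) := by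
  rcases isEmpty_or_nonempty (Fin s → X) with he | ⟨⟨x⟩⟩
  · have : Nonempty X := by
      by_contra hX
      rw [not_nonempty_iff] at hX
      exact IsProbabilityMeasure.ne_zero U (Measure.eq_zero_of_isEmpty U)
    exact (he.false fun _ => Classical.arbitrary X).elim
  · rw [lintegral_eq_lmarginal_univ x, lmarginal_erase' _ hf (Finset.mem_univ a)]
    have h1 := lmarginal_mono (μ := fun _ : Fin s => U) (s := Finset.univ.erase a)
      (f := fun _ => c) (g := fun x => ∫⁻ z, f (Function.update x a z) ∂U) h
    refine le_trans ?_ (h1 x)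
    simp [lmarginal]

/-- **Haussler's packing lemma**: policies at pairwise distance at least `ε` in a class of VC
dimension `d` number at most `(41/ε)^d`. For random points `x 1, …, x s`, the edges of the
one-inclusion graph of the traces have total weight at most `d M`, and on average at least
`s ε / 2 * (M - S)`, where `S` is the Sauer–Shelah bound on the number of distinct traces; with
`s ≈ 4 d / ε` it follows that `M ≤ 2 S`. -/
theorem card_le_of_separated [IsProbabilityMeasure U] (hd1 : 1 ≤ d)
    (hd : ∀ s : Finset X, Shatters 𝒞 s → s.card ≤ d) (hε : 0 < ε) (hε1 : ε ≤ 1)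
    (hv : ∀ j, v j ∈ 𝒞) (hm : ∀ j, Measurable (v j))
    (hsep : ∀ i j, i ≠ j → ENNReal.ofReal ε ≤ U {x | v i x ≠ v j x}) :
    (M : ℝ) ≤ (41 / ε) ^ d := by
  set s : ℕ := ⌈4 * d / ε⌉₊ with hs
  have hd0 : (1 : ℝ) ≤ d := by exact_mod_cast hd1
  have hs1 : 4 * d / ε ≤ s := Nat.le_ceil _
  have hs2 : (s : ℝ) ≤ 5 * d / ε := by
    have h1 : (s : ℝ) < 4 * d / ε + 1 := Nat.ceil_lt_add_one (by positivity)
    have h2 : 1 ≤ d / ε := by rw [le_div_iff₀ hε]; linarith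
    calc (s : ℝ) ≤ 4 * d / ε + d / ε := by linarith
      _ = 5 * d / ε := by ring
  have hds : d ≤ s := by
    have : (d : ℝ) ≤ 4 * d / ε := by rw [le_div_iff₀ hε]; nlinarith
    exact_mod_cast this.trans hs1
  set S : ℕ := ∑ k ∈ Finset.range (d + 1), s.choose k with hS
  have hlow : ∀ a : Fin s, ENNReal.ofReal (ε / 2 * (M - S)) ≤
      ∫⁻ x, (edgeWeight a (traceMatrix v x) : ℝ≥0∞) ∂(Measure.pi fun _ => U) := by
    intro a
    refine lintegral_pi_ge (measurable_edgeWeight hm a) a fun x => ?_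
    refine le_trans (ENNReal.ofReal_le_ofReal ?_) (lintegral_edgeWeight_ge hm hsep x a)
    have : ((Finset.univ.image (fun j => (column (traceMatrix v x) j).erase a)).card : ℝ) ≤ S := by
      exact_mod_cast card_classes_le hd hv x a
    gcongr
  have hup : ∑ a : Fin s, ∫⁻ x, (edgeWeight a (traceMatrix v x) : ℝ≥0∞) ∂(Measure.pi fun _ => U) ≤
      ((d * M : ℕ) : ℝ≥0∞) := by
    rw [← lintegral_finsetSum _ fun a _ => measurable_edgeWeight hm a]
    calc _ ≤ ∫⁻ _, ((d * M : ℕ) : ℝ≥0∞) ∂(Measure.pi fun _ : Fin s => U) := by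
          refine lintegral_mono fun x => ?_
          rw [← Nat.cast_sum]
          exact Nat.cast_le.2 (sum_edgeWeight_le hd hv x)
      _ = _ := by simp
  have hmain : (s : ℝ) * (ε / 2 * (M - S)) ≤ d * M := by
    by_cases hneg : (M : ℝ) - S ≤ 0
    · have : (s : ℝ) * (ε / 2 * (M - S)) ≤ 0 :=
        mul_nonpos_of_nonneg_of_nonpos (by positivity)
          (mul_nonpos_of_nonneg_of_nonpos (by positivity) hneg)
      exact this.trans (by positivity)
    · have h1 := (Finset.sum_le_sum fun a (_ : a ∈ Finset.univ) => hlow a).trans hup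
      rw [Finset.sum_const, Finset.card_univ, Fintype.card_fin, nsmul_eq_mul,
        ← ENNReal.ofReal_natCast, ← ENNReal.ofReal_natCast, ← ENNReal.ofReal_mul (by positivity),
        ENNReal.ofReal_le_ofReal_iff (by positivity)] at h1
      exact_mod_cast h1
  have hMS : (M : ℝ) ≤ 2 * S := by
    by_contra hlt
    push Not at hlt
    have h1 : 2 * d ≤ s * (ε / 2) := by
      rw [div_le_iff₀ hε] at hs1; linarith
    have h2 : 2 * d * ((M : ℝ) - S) ≤ s * (ε / 2) * (M - S) := by
      refine mul_le_mul_of_nonneg_right h1 ?_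
      have : (0 : ℝ) ≤ S := by positivity
      linarith
    have h3 : (d : ℝ) * (M - 2 * S) ≤ 0 := by linarith
    have h4 : 0 < (d : ℝ) * (M - 2 * S) := mul_pos (by linarith) (by linarith)
    linarith
  have he : Real.exp 1 ≤ 2.75 := by linarith [Real.exp_one_lt_d9]
  calc (M : ℝ) ≤ 2 * S := hMS
    _ ≤ 2 ^ d * (Real.exp 1 * s / d) ^ d := by
        gcongr
        · exact le_self_pow₀ (by norm_num) (by omega)
        · exact sum_choose_le_pow hd1 hds
    _ = (2 * (Real.exp 1 * s / d)) ^ d := by rw [mul_pow]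
    _ ≤ (41 / ε) ^ d := by
        gcongr
        calc 2 * (Real.exp 1 * s / d) ≤ 2 * (2.75 * (5 * d / ε) / d) := by gcongr
          _ = 27.5 / ε := by field_simp; norm_num
          _ ≤ 41 / ε := by gcongr; norm_num

/-- A maximal `ε`-separated subset of `𝒞` is a smooth `ε`-cover. -/
theorem exists_smoothCover [IsProbabilityMeasure U] (hd1 : 1 ≤ d)
    (hd : HasVCDim 𝒞 d) (hε : 0 < ε) (hε1 : ε ≤ 1) (hm : ∀ π ∈ 𝒞, Measurable π) :
    ∃ (N : ℕ) (Q : Fin N → X → Bool), (N : ℝ) ≤ (41 / ε) ^ d ∧ IsSmoothCover U ε 𝒞 Q := by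
  classical
  let p : ℕ → Prop := fun M => ∃ v : Fin M → X → Bool, (∀ j, v j ∈ 𝒞) ∧
    ∀ i j, i ≠ j → ENNReal.ofReal ε < U {x | v i x ≠ v j x}
  have hp : ∀ M, p M → (M : ℝ) ≤ (41 / ε) ^ d := by
    rintro M ⟨v, hv, hs⟩
    exact card_le_of_separated hd1 hd.2 hε hε1 hv (fun j => hm _ (hv j)) fun i j h => (hs i j h).le
  have hp0 : p 0 := ⟨fun i => i.elim0, fun i => i.elim0, fun i => i.elim0⟩
  set B := ⌊(41 / ε) ^ d⌋₊
  have hpB : ∀ M, p M → M ≤ B := fun M h => Nat.le_floor (hp M h)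
  obtain ⟨v, hv, hs⟩ := Nat.findGreatest_spec (P := p) (Nat.zero_le B) hp0
  refine ⟨_, v, hp _ ⟨v, hv, hs⟩, fun i => hm _ (hv i), fun π hπ => ?_⟩
  -- a policy that is not covered would enlarge the separated family
  by_contra hcon
  push Not at hcon
  have : p (Nat.findGreatest p B + 1) := by
    refine ⟨Fin.cons π v, fun j => ?_, fun i j => ?_⟩
    · refine Fin.cases hπ (fun j => ?_) j
      simpa using hv j
    · refine Fin.cases ?_ (fun i => ?_) i <;> refine Fin.cases ?_ (fun j => ?_) j
      · simp
      · intro _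
        simpa [ne_comm] using hcon j
      · intro _
        simpa using hcon i
      · intro hij
        simpa using hs i j (fun h => hij (by rw [h]))
  have h1 := Nat.le_findGreatest (hpB _ this) this
  omega

end Packing


/-! ### Adversarial covers of classes of finite Littlestone dimension -/

theorem exists_treeShattered_succ {X : Type*} {𝒞 : Set (X → Bool)} {k : ℕ} (x : X)
    (h : ∀ c, ∃ tree, TreeShattered {π ∈ 𝒞 | π x = c} k tree) :
    ∃ tree, TreeShattered 𝒞 (k + 1) tree := by
  choose tree htree using h
  refine ⟨fun l => match l with
    | [] => x
    | c :: l => tree c l, fun b hb => ?_⟩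
  obtain _ | ⟨c, b⟩ := b
  · simp at hb
  · obtain ⟨π, ⟨hπ, hx⟩, hπb⟩ := htree c b (by simpa using hb)
    refine ⟨π, hπ, fun i hi => ?_⟩
    obtain _ | i := i
    · simpa using hx
    · simpa using hπb i (by simpa using hi)

theorem TreeShattered.mono {X : Type*} {𝒞 𝒟 : Set (X → Bool)} {k : ℕ} {tree : List Bool → X}
    (h : 𝒞 ⊆ 𝒟) (ht : TreeShattered 𝒞 k tree) : TreeShattered 𝒟 k tree := fun b hb =>
  let ⟨π, hπ, hb⟩ := ht b hb
  ⟨π, h hπ, hb⟩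

/-- The expert that predicts `c x` in the first round and follows the expert `E x₁` afterwards,
where `x₁` is the first input. The expert `E x₁` does not see the first round. -/
def branchExpert {X : Type*} (c : X → Bool) (E : X → Expert X) : Expert X := fun past x =>
  match past.getLast? with
  | none => c x
  | some x₁ => E x₁ past.dropLast x

theorem branchExpert_eq {X : Type*} {c : X → Bool} {E : X → Expert X} {π : X → Bool} {x₁ : X}
    {ys : List X} (hc : c x₁ = π x₁)
    (hE : ∀ (x : X) (past : List X), (x :: past) <:+ ys → E x₁ past x = π x)
    (x : X) (past : List X) (h : (x :: past) <:+ ys ++ [x₁]) : branchExpert c E past x = π x := by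
  obtain ⟨t, ht⟩ := h
  rcases List.eq_nil_or_concat past with rfl | ⟨past, z, rfl⟩
  · obtain ⟨-, h2⟩ := List.append_inj' ht rfl
    obtain rfl : x = x₁ := by simpa using h2
    exact hc
  · have ht' : (t ++ x :: past) ++ [z] = ys ++ [x₁] := by simpa using ht
    obtain ⟨h1, h2⟩ := List.append_inj' ht' rfl
    obtain rfl : z = x₁ := by simpa using h2
    simpa [branchExpert] using hE x past ⟨t, h1⟩

/-- Induction on the horizon: on one of the two branches determined by the mentor's action on the
first input the class shatters no tree of depth `k - 1`, so the sizes of the covers add up by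
Pascal's rule. -/
theorem exists_adversarialCover_of_not_treeShattered {X : Type*} [Nonempty X] (T : ℕ) :
    ∀ (𝒞 : Set (X → Bool)) (k : ℕ), (¬ ∃ tree, TreeShattered 𝒞 k tree) →
      ∃ E : Fin (∑ i ∈ Finset.range k, T.choose i) → Expert X, IsAdversarialCover T 𝒞 E := by
  induction T with
  | zero =>
    intro 𝒞 k hk
    refine ⟨fun _ _ _ => true, fun π hπ xs hxs => ?_⟩
    obtain rfl : xs = [] := by simpa using hxs
    obtain _ | k := k
    · exact (hk ⟨fun _ => Classical.arbitrary X, fun b hb => ⟨π, hπ, fun i hi => by omega⟩⟩).elim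
    · refine ⟨⟨0, ?_⟩, fun x past h => by simp at h⟩
      exact Finset.sum_pos' (fun _ _ => Nat.zero_le _) ⟨0, by simp, by simp⟩
  | succ T ih =>
    intro 𝒞 k hk
    obtain _ | k := k
    · refine ⟨fun _ _ _ => true, fun π hπ xs hxs => ?_⟩
      obtain _ | ⟨x, xs⟩ := xs
      · simp at hxs
      · exact (hk ⟨fun _ => x, fun b hb => ⟨π, hπ, fun i hi => by omega⟩⟩).elim
    · have h1 : ∀ x, ∃ c, ¬ ∃ tree, TreeShattered {π ∈ 𝒞 | π x = !c} k tree := by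
        intro x
        by_contra hcon
        push Not at hcon
        exact hk (exists_treeShattered_succ x fun c => by simpa using hcon (!c))
      choose c hc using h1
      choose E₂ hE₂ using fun x => ih {π ∈ 𝒞 | π x = !c x} k (hc x)
      choose E₁ hE₁ using fun x => ih {π ∈ 𝒞 | π x = c x} (k + 1)
        fun ⟨tree, ht⟩ => hk ⟨tree, ht.mono fun π h => h.1⟩
      have hcard : ∑ i ∈ Finset.range (k + 1), (T + 1).choose i =
          (∑ i ∈ Finset.range (k + 1), T.choose i) + ∑ i ∈ Finset.range k, T.choose i := by
        rw [Finset.sum_range_succ', Finset.sum_range_succ' (fun i => T.choose i)]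
        simp only [Nat.choose_succ_succ, Finset.sum_add_distrib, Nat.choose_zero_right]
        ring
      rw [hcard]
      refine ⟨fun i => Sum.elim (fun j => branchExpert c fun x => E₁ x j)
        (fun j => branchExpert (fun x => !c x) fun x => E₂ x j) (finSumFinEquiv.symm i),
        fun π hπ xs hxs => ?_⟩
      obtain rfl | ⟨ys, x₁, rfl⟩ := List.eq_nil_or_concat xs
      · simp at hxs
      · have hys : ys.length = T := by simpa using hxs
        by_cases hcx : π x₁ = c x₁
        · obtain ⟨j, hj⟩ := hE₁ x₁ π ⟨hπ, hcx⟩ ys hys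
          refine ⟨finSumFinEquiv (Sum.inl j), fun x past h => ?_⟩
          simp only [Equiv.symm_apply_apply, Sum.elim_inl]
          exact branchExpert_eq hcx.symm hj x past (by simpa using h)
        · have hcx' : π x₁ = !c x₁ := Bool.eq_not_of_ne hcx
          obtain ⟨j, hj⟩ := hE₂ x₁ π ⟨hπ, hcx'⟩ ys hys
          refine ⟨finSumFinEquiv (Sum.inr j), fun x past h => ?_⟩
          simp only [Equiv.symm_apply_apply, Sum.elim_inr]
          exact branchExpert_eq hcx'.symm hj x past (by simpa using h)

theorem exists_adversarialCover {X : Type*} {𝒞 : Set (X → Bool)} {d T : ℕ} (hd1 : 1 ≤ d)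
    (hd : HasLittlestoneDim 𝒞 d) (hT : d ≤ T) :
    ∃ (N : ℕ) (E : Fin N → Expert X), (N : ℝ) ≤ (Real.exp 1 * T / d) ^ d ∧
      IsAdversarialCover T 𝒞 E := by
  have : Nonempty X := let ⟨tree, _⟩ := hd.1; ⟨tree []⟩
  obtain ⟨E, hE⟩ := exists_adversarialCover_of_not_treeShattered T 𝒞 (d + 1)
    fun h => absurd (hd.2 _ h) (by omega)
  exact ⟨_, E, sum_choose_le_pow hd1 hT, hE⟩


/-! ### Expectations over the agent's choices -/

section AgentMean

variable {X : Type*} [PseudoMetricSpace X] [MeasurableSpace X] {N : ℕ} {Ω : Type*}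
  [MeasurableSpace Ω] {T : ℕ} {L μmin : ℝ} {A : Params X N} {G : Environment X N Ω T L μmin} {ω : Ω}

/-- The real number whose image in `[0,∞]` is `choiceProb A s o`. -/
noncomputable def choiceReal {X : Type*} {N : ℕ} (A : Params X N) (s : AgentState X N) :
    Outcome N → ℝ
  | none => A.p
  | some i => (1 - A.p) * (s.w i / ∑ j, s.w j)

theorem choiceProb_eq_ofReal {X : Type*} {N : ℕ} (A : Params X N) (s : AgentState X N)
    (o : Outcome N) : choiceProb A s o = ENNReal.ofReal (choiceReal A s o) := by
  cases o <;> rfl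

theorem stateAfter_w_pos (h : List (Outcome N)) (i : Fin N) : 0 < (stateAfter A G ω h).w i := by
  induction h with
  | nil => simp [stateAfter, AgentState.init]
  | cons o h ih =>
    cases o with
    | none => simpa [stateAfter, nextState] using mul_pos ih (Real.exp_pos _)
    | some j => simpa [stateAfter, nextState] using ih

theorem sum_stateAfter_w_pos (hN : 0 < N) (h : List (Outcome N)) :
    0 < ∑ i, (stateAfter A G ω h).w i := by
  have : NeZero N := ⟨hN.ne'⟩
  exact Finset.sum_pos (fun i _ => stateAfter_w_pos h i) Finset.univ_nonempty

theorem choiceReal_nonneg (hp0 : 0 ≤ A.p) (hp1 : A.p ≤ 1) (h : List (Outcome N)) (o : Outcome N) :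
    0 ≤ choiceReal A (stateAfter A G ω h) o := by
  cases o with
  | none => exact hp0
  | some i => exact mul_nonneg (by linarith) (div_nonneg (stateAfter_w_pos h i).le
      (Finset.sum_nonneg fun j _ => (stateAfter_w_pos h j).le))

theorem sum_choiceReal_mul (f : Outcome N → ℝ) (h : List (Outcome N)) :
    ∑ o, choiceReal A (stateAfter A G ω h) o * f o = A.p * f none + (1 - A.p) *
      ∑ i, (stateAfter A G ω h).w i / (∑ j, (stateAfter A G ω h).w j) * f (some i) := by
  rw [Fintype.sum_option, Finset.mul_sum]
  simp only [choiceReal, mul_assoc]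

theorem sum_weight_div (hN : 0 < N) (h : List (Outcome N)) :
    ∑ i, (stateAfter A G ω h).w i / (∑ j, (stateAfter A G ω h).w j) = 1 := by
  rw [← Finset.sum_div, div_self (sum_stateAfter_w_pos hN h).ne']

theorem sum_choiceReal (hN : 0 < N) (h : List (Outcome N)) :
    ∑ o, choiceReal A (stateAfter A G ω h) o = 1 := by
  have := sum_choiceReal_mul (A := A) (G := G) (ω := ω) (fun _ => 1) h
  simp only [mul_one] at this
  rw [this, sum_weight_div hN]
  ring

theorem sum_choiceProb (hN : 0 < N) (hp0 : 0 ≤ A.p) (hp1 : A.p ≤ 1) (h : List (Outcome N)) :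
    ∑ o, choiceProb A (stateAfter A G ω h) o = 1 := by
  simp only [choiceProb_eq_ofReal]
  rw [← ENNReal.ofReal_sum_of_nonneg fun o _ => choiceReal_nonneg hp0 hp1 h o, sum_choiceReal hN,
    ENNReal.ofReal_one]

/-- The real-valued counterpart of `agentMean`. -/
noncomputable def agentMeanReal (A : Params X N) (G : Environment X N Ω T L μmin) (ω : Ω)
    (f : List (Outcome N) → ℝ) : ℕ → List (Outcome N) → ℝ
  | 0, h => f h
  | k + 1, h => ∑ o : Outcome N, choiceReal A (stateAfter A G ω h) o *
      agentMeanReal A G ω f k (o :: h)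

theorem agentMeanReal_nonneg (hp0 : 0 ≤ A.p) (hp1 : A.p ≤ 1) {f : List (Outcome N) → ℝ}
    (hf : ∀ h, 0 ≤ f h) (k : ℕ) : ∀ h, 0 ≤ agentMeanReal A G ω f k h := by
  induction k with
  | zero => exact hf
  | succ k ih =>
    exact fun h => Finset.sum_nonneg fun o _ => mul_nonneg (choiceReal_nonneg hp0 hp1 h o) (ih _)

theorem agentMean_ofReal (hp0 : 0 ≤ A.p) (hp1 : A.p ≤ 1) {f : List (Outcome N) → ℝ}
    (hf : ∀ h, 0 ≤ f h) (k : ℕ) : ∀ h, agentMean A G ω (fun h => ENNReal.ofReal (f h)) k h =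
      ENNReal.ofReal (agentMeanReal A G ω f k h) := by
  induction k with
  | zero => exact fun h => rfl
  | succ k ih =>
    intro h
    simp only [agentMean, agentMeanReal]
    rw [ENNReal.ofReal_sum_of_nonneg fun o _ =>
      mul_nonneg (choiceReal_nonneg hp0 hp1 h o) (agentMeanReal_nonneg hp0 hp1 hf k _)]
    refine Finset.sum_congr rfl fun o _ => ?_
    rw [ih, choiceProb_eq_ofReal, ENNReal.ofReal_mul (choiceReal_nonneg hp0 hp1 h o)]

theorem agentMean_mono {f g : List (Outcome N) → ℝ≥0∞} (k : ℕ) : ∀ h : List (Outcome N),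
    (∀ h' : List (Outcome N), h'.length = h.length + k → f h' ≤ g h') →
      agentMean A G ω f k h ≤ agentMean A G ω g k h := by
  induction k with
  | zero => exact fun h hfg => hfg h rfl
  | succ k ih =>
    refine fun h hfg => Finset.sum_le_sum fun o _ => mul_le_mul_right (ih _ fun h' hh' => ?_) _
    exact hfg h' (by rw [hh', List.length_cons]; ring)

theorem agentMeanReal_mono (hp0 : 0 ≤ A.p) (hp1 : A.p ≤ 1) {f g : List (Outcome N) → ℝ} (k : ℕ) :
    ∀ h : List (Outcome N),
    (∀ h' : List (Outcome N), h'.length = h.length + k → f h' ≤ g h') →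
      agentMeanReal A G ω f k h ≤ agentMeanReal A G ω g k h := by
  induction k with
  | zero => exact fun h hfg => hfg h rfl
  | succ k ih =>
    refine fun h hfg => Finset.sum_le_sum fun o _ =>
      mul_le_mul_of_nonneg_left (ih _ fun h' hh' => ?_) (choiceReal_nonneg hp0 hp1 h o)
    exact hfg h' (by rw [hh', List.length_cons]; ring)

theorem agentMean_add (f g : List (Outcome N) → ℝ≥0∞) (k : ℕ) : ∀ h,
    agentMean A G ω (fun h => f h + g h) k h = agentMean A G ω f k h + agentMean A G ω g k h := by
  induction k with
  | zero => exact fun h => rfl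
  | succ k ih =>
    intro h
    simp only [agentMean, ih, mul_add, Finset.sum_add_distrib]

theorem agentMean_const_mul (c : ℝ≥0∞) (f : List (Outcome N) → ℝ≥0∞) (k : ℕ) : ∀ h,
    agentMean A G ω (fun h => c * f h) k h = c * agentMean A G ω f k h := by
  induction k with
  | zero => exact fun h => rfl
  | succ k ih =>
    intro h
    simp only [agentMean, ih, Finset.mul_sum]
    exact Finset.sum_congr rfl fun o _ => mul_left_comm _ _ _

theorem agentMean_const (hN : 0 < N) (hp0 : 0 ≤ A.p) (hp1 : A.p ≤ 1) (c : ℝ≥0∞) (k : ℕ) :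
    ∀ h, agentMean A G ω (fun _ => c) k h = c := by
  induction k with
  | zero => exact fun h => rfl
  | succ k ih =>
    intro h
    simp only [agentMean, ih, ← Finset.sum_mul, sum_choiceProb hN hp0 hp1, one_mul]

theorem agentMeanReal_sub (f g : List (Outcome N) → ℝ) (k : ℕ) : ∀ h,
    agentMeanReal A G ω (fun h => f h - g h) k h =
      agentMeanReal A G ω f k h - agentMeanReal A G ω g k h := by
  induction k with
  | zero => exact fun h => rfl
  | succ k ih =>
    intro h
    simp only [agentMeanReal, ih, mul_sub, Finset.sum_sub_distrib]

theorem agentMeanReal_const_mul (c : ℝ) (f : List (Outcome N) → ℝ) (k : ℕ) : ∀ h,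
    agentMeanReal A G ω (fun h => c * f h) k h = c * agentMeanReal A G ω f k h := by
  induction k with
  | zero => exact fun h => rfl
  | succ k ih =>
    intro h
    simp only [agentMeanReal, ih, Finset.mul_sum]
    exact Finset.sum_congr rfl fun o _ => mul_left_comm _ _ _

/-- A functional of the history that does not increase on average in any round is a
supermartingale. -/
theorem agentMeanReal_le_of_step (hp0 : 0 ≤ A.p) (hp1 : A.p ≤ 1) {f : List (Outcome N) → ℝ}
    (hf : ∀ h, ∑ o, choiceReal A (stateAfter A G ω h) o * f (o :: h) ≤ f h) (k : ℕ) :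
    ∀ h, agentMeanReal A G ω f k h ≤ f h := by
  induction k with
  | zero => exact fun h => le_rfl
  | succ k ih =>
    exact fun h => (Finset.sum_le_sum fun o _ =>
      mul_le_mul_of_nonneg_left (ih (o :: h)) (choiceReal_nonneg hp0 hp1 h o)).trans (hf h)

/-- The sum over the rounds of the history of a cost that depends on the earlier rounds and the
agent's choice. -/
noncomputable def historySum {N : ℕ} (c : List (Outcome N) → Outcome N → ℝ) : List (Outcome N) → ℝ
  | [] => 0
  | o :: h => c h o + historySum c h

theorem historySum_nonneg {N : ℕ} {c : List (Outcome N) → Outcome N → ℝ} (hc : ∀ h o, 0 ≤ c h o)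
    (h : List (Outcome N)) : 0 ≤ historySum c h := by
  induction h with
  | nil => exact le_rfl
  | cons o h ih => exact add_nonneg (hc h o) ih

/-! ### The Hedge bound on the number of wrong samples -/

/-- The loss of the `i`-th expert in the round after history `h`. -/
noncomputable def lossAt (A : Params X N) (G : Environment X N Ω T L μmin) (ω : Ω)
    (h : List (Outcome N)) (i : Fin N) : ℝ :=
  loss A (stateAfter A G ω h) (G.input ω h) (G.mentor (G.input ω h)) i

/-- Whether the agent's choice in the round after history `h` is a wrong sample (`1`) or not (`0`),
that is, whether an expert is sampled whose prediction differs from the mentor's action. -/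
noncomputable def wrongAt (A : Params X N) (G : Environment X N Ω T L μmin) (ω : Ω)
    (h : List (Outcome N)) : Outcome N → ℝ
  | none => 0
  | some i => lossAt A G ω h i

/-- The number of wrong samples in the history. The agent may have queried in such a round. -/
noncomputable def wrongSamples (A : Params X N) (G : Environment X N Ω T L μmin) (ω : Ω) :
    List (Outcome N) → ℝ :=
  historySum (wrongAt A G ω)

/-- The total loss of the `i`-th expert. -/
noncomputable def totalLoss (A : Params X N) (G : Environment X N Ω T L μmin) (ω : Ω) (i : Fin N) :
    List (Outcome N) → ℝ :=
  historySum fun h _ => lossAt A G ω h i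

/-- The number of rounds of the history in which all experts were wrong. -/
noncomputable def totalMinLoss (A : Params X N) (G : Environment X N Ω T L μmin) (ω : Ω) :
    List (Outcome N) → ℝ :=
  historySum fun h _ => ⨅ j, lossAt A G ω h j

theorem lossAt_eq (h : List (Outcome N)) (i : Fin N) :
    lossAt A G ω h i = 0 ∨ lossAt A G ω h i = 1 := by
  unfold lossAt loss
  split_ifs <;> simp

theorem lossAt_nonneg (h : List (Outcome N)) (i : Fin N) : 0 ≤ lossAt A G ω h i := by
  rcases lossAt_eq (A := A) (G := G) (ω := ω) h i with e | e <;> simp [e]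

theorem lossAt_le_one (h : List (Outcome N)) (i : Fin N) : lossAt A G ω h i ≤ 1 := by
  rcases lossAt_eq (A := A) (G := G) (ω := ω) h i with e | e <;> simp [e]

theorem iInf_lossAt_le (h : List (Outcome N)) (i : Fin N) :
    ⨅ j, lossAt A G ω h j ≤ lossAt A G ω h i :=
  ciInf_le (Finite.bddBelow_range _) i

theorem iInf_lossAt_nonneg (h : List (Outcome N)) : 0 ≤ ⨅ j, lossAt A G ω h j :=
  Real.iInf_nonneg fun j => lossAt_nonneg h j

theorem lossAt_sub_iInf_eq (h : List (Outcome N)) (i : Fin N) :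
    lossAt A G ω h i - ⨅ j, lossAt A G ω h j = 0 ∨
      lossAt A G ω h i - ⨅ j, lossAt A G ω h j = 1 := by
  have : Nonempty (Fin N) := ⟨i⟩
  obtain ⟨j, hj⟩ := exists_eq_ciInf_of_finite (f := lossAt A G ω h)
  have h1 := iInf_lossAt_le (A := A) (G := G) (ω := ω) h i
  rw [← hj] at h1 ⊢
  rcases lossAt_eq (A := A) (G := G) (ω := ω) h i with e | e <;>
    rcases lossAt_eq (A := A) (G := G) (ω := ω) h j with e' | e' <;> rw [e, e'] at h1 ⊢ <;> norm_num
  norm_num at h1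

theorem wrongAt_nonneg (h : List (Outcome N)) (o : Outcome N) : 0 ≤ wrongAt A G ω h o := by
  cases o with
  | none => exact le_rfl
  | some i => exact lossAt_nonneg h i

theorem wrongAt_le_one (h : List (Outcome N)) (o : Outcome N) : wrongAt A G ω h o ≤ 1 := by
  cases o with
  | none => exact zero_le_one
  | some i => exact lossAt_le_one h i

theorem wrongSamples_cons (h : List (Outcome N)) (o : Outcome N) :
    wrongSamples A G ω (o :: h) = wrongAt A G ω h o + wrongSamples A G ω h := rfl

theorem wrongSamples_nonneg (h : List (Outcome N)) : 0 ≤ wrongSamples A G ω h :=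
  historySum_nonneg wrongAt_nonneg h

theorem wrongSamples_le_length (h : List (Outcome N)) : wrongSamples A G ω h ≤ h.length := by
  induction h with
  | nil => simp [wrongSamples, historySum]
  | cons o h ih =>
    rw [wrongSamples_cons, List.length_cons, Nat.cast_succ]
    linarith [wrongAt_le_one (A := A) (G := G) (ω := ω) h o]

theorem totalLoss_nonneg (i : Fin N) (h : List (Outcome N)) : 0 ≤ totalLoss A G ω i h :=
  historySum_nonneg (fun h _ => lossAt_nonneg h i) h

theorem totalMinLoss_nonneg (h : List (Outcome N)) : 0 ≤ totalMinLoss A G ω h :=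
  historySum_nonneg (fun h _ => iInf_lossAt_nonneg h) h

theorem totalMinLoss_le (i : Fin N) (h : List (Outcome N)) :
    totalMinLoss A G ω h ≤ totalLoss A G ω i h := by
  induction h with
  | nil => exact le_rfl
  | cons o h ih => exact add_le_add (iInf_lossAt_le h i) ih

theorem exp_neg_le_one_sub_half {u : ℝ} (h0 : 0 ≤ u) (h1 : u ≤ 1) : Real.exp (-u) ≤ 1 - u / 2 := by
  rw [Real.exp_neg]
  have h2 : 1 + u ≤ Real.exp u := by linarith [Real.add_one_le_exp u]
  calc (Real.exp u)⁻¹ ≤ (1 + u)⁻¹ := by gcongr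
    _ ≤ 1 - u / 2 := by
      rw [inv_le_iff_one_le_mul₀ (by linarith)]
      nlinarith

/-- The decrease of the logarithm of the total weight in a Hedge query. The scaled losses take the
values `0` and `1` only, so no second-order term appears. -/
theorem log_weight_step (hN : 0 < N) (hη : 0 < A.η) (hηp : A.η ≤ A.p) (h : List (Outcome N)) :
    Real.log (∑ i, (stateAfter A G ω (none :: h)).w i) ≤
      Real.log (∑ i, (stateAfter A G ω h).w i) -
      A.η / A.p / 2 * ∑ i, (stateAfter A G ω h).w i / (∑ j, (stateAfter A G ω h).w j) *
        (lossAt A G ω h i - ⨅ j, lossAt A G ω h j) := by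
  have hp : 0 < A.p := hη.trans_le hηp
  set W := ∑ j, (stateAfter A G ω h).w j with hW
  have hW0 : 0 < W := sum_stateAfter_w_pos hN h
  set z := ∑ i, (stateAfter A G ω h).w i / W * (lossAt A G ω h i - ⨅ j, lossAt A G ω h j) with hz
  have hW'0 : 0 < ∑ i, (stateAfter A G ω (none :: h)).w i := sum_stateAfter_w_pos hN _
  have hu0 : 0 ≤ A.η / A.p := by positivity
  have hu1 : A.η / A.p ≤ 1 := (div_le_one hp).2 hηp
  have hW' : ∑ i, (stateAfter A G ω (none :: h)).w i ≤ W * (1 - A.η / A.p / 2 * z) := by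
    have e : W * (1 - A.η / A.p / 2 * z) = ∑ i, (stateAfter A G ω h).w i *
        (1 - A.η / A.p / 2 * (lossAt A G ω h i - ⨅ j, lossAt A G ω h j)) := by
      have : W * z = ∑ i, (stateAfter A G ω h).w i *
          (lossAt A G ω h i - ⨅ j, lossAt A G ω h j) := by
        rw [hz, Finset.mul_sum]
        refine Finset.sum_congr rfl fun i _ => ?_
        field_simp
      simp only [mul_sub, mul_one, Finset.sum_sub_distrib]
      rw [← hW]
      congr 1
      calc W * (A.η / A.p / 2 * z) = A.η / A.p / 2 * (W * z) := by ring
        _ = _ := by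
          rw [this, Finset.mul_sum, ← Finset.sum_sub_distrib]
          refine Finset.sum_congr rfl fun i _ => ?_
          ring
    rw [e]
    refine Finset.sum_le_sum fun i _ => ?_
    change (stateAfter A G ω h).w i *
      Real.exp (-A.η * ((lossAt A G ω h i - ⨅ j, lossAt A G ω h j) / A.p)) ≤ _
    refine mul_le_mul_of_nonneg_left ?_ (stateAfter_w_pos h i).le
    rcases lossAt_sub_iInf_eq (A := A) (G := G) (ω := ω) h i with e | e
    · rw [e]; simp
    · rw [e]
      have := exp_neg_le_one_sub_half hu0 hu1
      calc Real.exp (-A.η * (1 / A.p)) = Real.exp (-(A.η / A.p)) := by congr 1; ring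
        _ ≤ _ := by linarith
  have h1 := Real.log_le_sub_one_of_pos (div_pos hW'0 hW0)
  rw [Real.log_div hW'0.ne' hW0.ne'] at h1
  have h2 : (∑ i, (stateAfter A G ω (none :: h)).w i) / W ≤ 1 - A.η / A.p / 2 * z := by
    rw [div_le_iff₀ hW0]; linarith
  linarith

/-- The potential of the Hedge analysis. The expected number of wrong samples in a round is paid for
by the expected decrease of `log W` and by the minimal loss of that round. -/
noncomputable def hedgePotential (A : Params X N) (G : Environment X N Ω T L μmin) (ω : Ω)
    (h : List (Outcome N)) : ℝ :=
  wrongSamples A G ω h + 2 / A.η * Real.log (∑ i, (stateAfter A G ω h).w i) - totalMinLoss A G ω h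

theorem hedgePotential_step (hN : 0 < N) (hη : 0 < A.η) (hηp : A.η ≤ A.p)
    (h : List (Outcome N)) :
    ∑ o, choiceReal A (stateAfter A G ω h) o * hedgePotential A G ω (o :: h) ≤
      hedgePotential A G ω h := by
  have hp : 0 < A.p := hη.trans_le hηp
  have hstep := log_weight_step (G := G) (ω := ω) hN hη hηp h
  rw [sum_choiceReal_mul]
  set m := ⨅ j, lossAt A G ω h j with hm
  set W := ∑ j, (stateAfter A G ω h).w j with hW
  have hsome : ∀ i, hedgePotential A G ω (some i :: h) =
      (hedgePotential A G ω h) + (lossAt A G ω h i - m) := by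
    intro i
    change lossAt A G ω h i + wrongSamples A G ω h + 2 / A.η * Real.log W -
      (m + totalMinLoss A G ω h) = _
    rw [hedgePotential]
    ring
  have hnone : hedgePotential A G ω (none :: h) = hedgePotential A G ω h - m + 2 / A.η *
      (Real.log (∑ i, (stateAfter A G ω (none :: h)).w i) - Real.log W) := by
    change 0 + wrongSamples A G ω h + 2 / A.η *
      Real.log (∑ i, (stateAfter A G ω (none :: h)).w i) - (m + totalMinLoss A G ω h) = _
    rw [hedgePotential]
    ring
  rw [hnone]
  simp only [hsome, mul_add, Finset.sum_add_distrib]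
  rw [← Finset.sum_mul, sum_weight_div hN h]
  set z := ∑ i, (stateAfter A G ω h).w i / W * (lossAt A G ω h i - m) with hz
  have hz0 : 0 ≤ z := Finset.sum_nonneg fun i _ => mul_nonneg
    (div_nonneg (stateAfter_w_pos h i).le (sum_stateAfter_w_pos hN h).le)
    (by linarith [iInf_lossAt_le (A := A) (G := G) (ω := ω) h i])
  have hm0 : 0 ≤ m := iInf_lossAt_nonneg h
  have h3 : A.p * (2 / A.η * (Real.log (∑ i, (stateAfter A G ω (none :: h)).w i) - Real.log W)) ≤
      A.p * (2 / A.η * (-(A.η / A.p / 2 * z))) := by gcongr; linarith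
  have h4 : A.p * (2 / A.η * (-(A.η / A.p / 2 * z))) = -z := by field_simp
  nlinarith [mul_nonneg hp.le hm0, mul_nonneg hp.le hz0]

theorem hedgePotential_nil : hedgePotential A G ω [] = 2 / A.η * Real.log N := by
  simp [hedgePotential, wrongSamples, totalMinLoss, historySum, stateAfter, AgentState.init]

theorem stateAfter_w_eq_one (i : Fin N) (h : List (Outcome N)) (h0 : totalLoss A G ω i h = 0) :
    (stateAfter A G ω h).w i = 1 := by
  induction h with
  | nil => rfl
  | cons o h ih =>
    have h1 : lossAt A G ω h i + totalLoss A G ω i h = 0 := h0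
    have h2 := lossAt_nonneg (A := A) (G := G) (ω := ω) h i
    have h3 := totalLoss_nonneg (A := A) (G := G) (ω := ω) i h
    have h4 : (stateAfter A G ω h).w i = 1 := ih (by linarith)
    cases o with
    | some j => exact h4
    | none =>
      change (stateAfter A G ω h).w i *
        Real.exp (-A.η * ((lossAt A G ω h i - ⨅ j, lossAt A G ω h j) / A.p)) = 1
      have h5 := iInf_lossAt_le (A := A) (G := G) (ω := ω) h i
      have h6 := iInf_lossAt_nonneg (A := A) (G := G) (ω := ω) h
      have h7 : lossAt A G ω h i - ⨅ j, lossAt A G ω h j = 0 := by linarith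
      rw [h4, h7]
      simp

/-- If in every run some expert, which may depend on the run, makes no mistake, then the comparison
costs nothing. -/
theorem agentMeanReal_wrongSamples_le_of_realizable (hN : 0 < N) (hη : 0 < A.η) (hηp : A.η ≤ A.p)
    (hp1 : A.p ≤ 1) (k : ℕ)
    (hreal : ∀ h : List (Outcome N), h.length = k → ∃ i, totalLoss A G ω i h = 0) :
    agentMeanReal A G ω (wrongSamples A G ω) k [] ≤ 2 / A.η * Real.log N := by
  have hp0 : 0 ≤ A.p := (hη.trans_le hηp).le
  rw [← hedgePotential_nil (A := A) (G := G) (ω := ω)]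
  refine le_trans (agentMeanReal_mono hp0 hp1 k [] fun h hh => ?_)
    (agentMeanReal_le_of_step hp0 hp1 (hedgePotential_step hN hη hηp) k [])
  obtain ⟨i, hi⟩ := hreal h (by simpa using hh)
  have h1 : 1 ≤ ∑ j, (stateAfter A G ω h).w j := by
    rw [← stateAfter_w_eq_one i h hi]
    exact Finset.single_le_sum (fun j _ => (stateAfter_w_pos h j).le) (Finset.mem_univ i)
  have h2 : 0 ≤ 2 / A.η * Real.log (∑ j, (stateAfter A G ω h).w j) :=
    mul_nonneg (by positivity) (Real.log_nonneg h1)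
  have h3 := totalMinLoss_le (A := A) (G := G) (ω := ω) i h
  rw [hedgePotential]
  linarith

/-- The logarithm of the weight of a fixed expert, compensated by the losses, is a martingale: a
Hedge query, of probability `p`, counts the loss with the factor `1 / p`. -/
theorem log_w_step (i : Fin N) (hN : 0 < N) (hη : 0 < A.η) (hp : 0 < A.p) (h : List (Outcome N)) :
    ∑ o, choiceReal A (stateAfter A G ω h) o *
      (2 * totalMinLoss A G ω (o :: h) - 2 * totalLoss A G ω i (o :: h) -
        2 / A.η * Real.log ((stateAfter A G ω (o :: h)).w i)) =
      2 * totalMinLoss A G ω h - 2 * totalLoss A G ω i h -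
        2 / A.η * Real.log ((stateAfter A G ω h).w i) := by
  rw [sum_choiceReal_mul]
  have e1 : ∀ o, totalMinLoss A G ω (o :: h) = (⨅ j, lossAt A G ω h j) + totalMinLoss A G ω h :=
    fun _ => rfl
  have e2 : ∀ o, totalLoss A G ω i (o :: h) = lossAt A G ω h i + totalLoss A G ω i h :=
    fun _ => rfl
  have e3 : ∀ j, (stateAfter A G ω (some j :: h)).w i = (stateAfter A G ω h).w i := fun _ => rfl
  have e4 : Real.log ((stateAfter A G ω (none :: h)).w i) = Real.log ((stateAfter A G ω h).w i) +
      -A.η * ((lossAt A G ω h i - ⨅ j, lossAt A G ω h j) / A.p) := by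
    change Real.log ((stateAfter A G ω h).w i *
        Real.exp (-A.η * ((lossAt A G ω h i - ⨅ j, lossAt A G ω h j) / A.p))) = _
    rw [Real.log_mul (stateAfter_w_pos h i).ne' (Real.exp_ne_zero _), Real.log_exp]
  simp only [e1, e2, e3, e4]
  rw [← Finset.sum_mul, sum_weight_div hN h]
  field_simp
  ring

/-- The comparison with a fixed expert. The term `log W` of the potential is bounded below by the
logarithm of that expert's weight. -/
theorem agentMeanReal_wrongSamples_le (i : Fin N) (hη : 0 < A.η) (hηp : A.η ≤ A.p)
    (hp1 : A.p ≤ 1) (k : ℕ) :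
    agentMeanReal A G ω (wrongSamples A G ω) k [] ≤
      2 / A.η * Real.log N + 2 * agentMeanReal A G ω (totalLoss A G ω i) k [] := by
  have hN : 0 < N := i.pos
  have hp : 0 < A.p := hη.trans_le hηp
  let f : List (Outcome N) → ℝ := fun h => hedgePotential A G ω h +
    (2 * totalMinLoss A G ω h - 2 * totalLoss A G ω i h -
        2 / A.η * Real.log ((stateAfter A G ω h).w i))
  have hf : ∀ h, ∑ o, choiceReal A (stateAfter A G ω h) o * f (o :: h) ≤ f h := by
    intro h
    simp only [f, mul_add (choiceReal _ _ _), Finset.sum_add_distrib]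
    rw [log_w_step i hN hη hp]
    exact add_le_add_left (hedgePotential_step hN hη hηp h) _
  have h1 := agentMeanReal_le_of_step hp.le hp1 hf k []
  have h2 : f [] = 2 / A.η * Real.log N := by
    simp only [f, hedgePotential_nil]
    simp [totalMinLoss, totalLoss, historySum, stateAfter, AgentState.init]
  have h3 := agentMeanReal_mono (A := A) (G := G) (ω := ω) hp.le hp1
    (f := fun h => wrongSamples A G ω h - 2 * totalLoss A G ω i h) (g := f) k [] fun h _ => by
      have h4 : Real.log ((stateAfter A G ω h).w i) ≤
          Real.log (∑ j, (stateAfter A G ω h).w j) :=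
        Real.log_le_log (stateAfter_w_pos h i)
          (Finset.single_le_sum (fun j _ => (stateAfter_w_pos h j).le) (Finset.mem_univ i))
      have h5 : 2 / A.η * Real.log ((stateAfter A G ω h).w i) ≤
          2 / A.η * Real.log (∑ j, (stateAfter A G ω h).w j) := by gcongr
      have h6 := totalMinLoss_nonneg (A := A) (G := G) (ω := ω) h
      simp only [f, hedgePotential]
      linarith
  rw [agentMeanReal_sub, agentMeanReal_const_mul] at h3
  linarith

end AgentMean


/-! ### The loss of a fixed policy on smooth inputs -/

theorem setLIntegral_le_mul_of_forall_inter_le {Ω : Type*} {m m0 : MeasurableSpace Ω} (hm : m ≤ m0)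
    {P : Measure Ω} {E : Set Ω} (c : ℝ≥0∞)
    (h : ∀ B, MeasurableSet[m] B → P (B ∩ E) ≤ c * P B) {ρ : Ω → ℝ≥0∞} (hρ : Measurable[m] ρ) :
    ∫⁻ ω in E, ρ ω ∂P ≤ c * ∫⁻ ω, ρ ω ∂P := by
  rw [← lintegral_trim hm hρ, ← lintegral_trim hm hρ, ← smul_eq_mul, ← lintegral_smul_measure]
  refine lintegral_mono' (Measure.le_iff.2 fun B hB => ?_) le_rfl
  rw [trim_measurableSet_eq hm hB, Measure.restrict_apply (hm _ hB), Measure.smul_apply,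
    trim_measurableSet_eq hm hB]
  exact h B hB

section Smooth

variable {X : Type*} [PseudoMetricSpace X] [MeasurableSpace X] {N : ℕ} {Ω : Type*}
  [mΩ : MeasurableSpace Ω] {T : ℕ} {L μmin : ℝ} {A : Params X N} {G : Environment X N Ω T L μmin}
  {Q : Fin N → X → Bool}

theorem lossAt_policyExpert (hA : A.expert = fun i => policyExpert (Q i)) (ω : Ω)
    (h : List (Outcome N)) (i : Fin N) :
    lossAt A G ω h i = Set.indicator {x | Q i x ≠ G.mentor x} (fun _ => (1 : ℝ)) (G.input ω h) := by
  by_cases h' : Q i (G.input ω h) = G.mentor (G.input ω h) <;>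
    simp [lossAt, loss, hA, policyExpert, Set.indicator, h']

theorem measurableSet_disagreement (hQ : ∀ i, Measurable (Q i)) (hmentor : Measurable G.mentor)
    (i : Fin N) : MeasurableSet {x | Q i x ≠ G.mentor x} :=
  (measurableSet_eq_fun (hQ i) hmentor).compl

variable {𝓕 : Filtration ℕ mΩ}

theorem measurable_lossAt (hA : A.expert = fun i => policyExpert (Q i)) (hQ : ∀ i, Measurable (Q i))
    (hmentor : Measurable G.mentor) {k : ℕ} {h : List (Outcome N)}
    (hinput : Measurable[𝓕 k] fun ω => G.input ω h) (i : Fin N) :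
    Measurable[𝓕 k] fun ω => lossAt A G ω h i := by
  simp only [lossAt_policyExpert hA]
  exact (measurable_const.indicator (measurableSet_disagreement hQ hmentor i)).comp hinput

theorem measurable_stateAfter_w (hA : A.expert = fun i => policyExpert (Q i))
    (hQ : ∀ i, Measurable (Q i)) (hmentor : Measurable G.mentor)
    (hinput : ∀ h : List (Outcome N), h.length < T →
      Measurable[𝓕 (h.length + 1)] fun ω => G.input ω h)
    (h : List (Outcome N)) (hh : h.length ≤ T) (i : Fin N) :
    Measurable[𝓕 h.length] fun ω => (stateAfter A G ω h).w i := by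
  induction h with
  | nil => exact measurable_const
  | cons o h ih =>
    have h1 : Measurable[𝓕 (h.length + 1)] fun ω => (stateAfter A G ω h).w i :=
      (ih (Nat.le_of_succ_le hh)).mono (𝓕.mono (Nat.le_succ _)) le_rfl
    cases o with
    | some j => exact h1
    | none =>
      have h2 : ∀ j, Measurable[𝓕 (h.length + 1)] fun ω => lossAt A G ω h j := fun j =>
        measurable_lossAt hA hQ hmentor (hinput h hh) j
      have h3 : Measurable[𝓕 (h.length + 1)] fun ω => ⨅ j, lossAt A G ω h j := Measurable.iInf h2
      exact h1.mul (Real.measurable_exp.comp ((((h2 i).sub h3).div_const A.p).const_mul (-A.η)))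

theorem measurable_choiceProb (hA : A.expert = fun i => policyExpert (Q i))
    (hQ : ∀ i, Measurable (Q i)) (hmentor : Measurable G.mentor)
    (hinput : ∀ h : List (Outcome N), h.length < T →
      Measurable[𝓕 (h.length + 1)] fun ω => G.input ω h)
    (h : List (Outcome N)) (hh : h.length ≤ T) (o : Outcome N) :
    Measurable[𝓕 h.length] fun ω => choiceProb A (stateAfter A G ω h) o := by
  have hw := measurable_stateAfter_w hA hQ hmentor hinput h hh
  cases o with
  | none => exact measurable_const
  | some i =>
    exact (((hw i).div (Finset.measurable_sum _ fun j _ => hw j)).const_mul _).ennreal_ofReal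

theorem measurable_agentMean (hA : A.expert = fun i => policyExpert (Q i))
    (hQ : ∀ i, Measurable (Q i)) (hmentor : Measurable G.mentor)
    (hinput : ∀ h : List (Outcome N), h.length < T →
      Measurable[𝓕 (h.length + 1)] fun ω => G.input ω h)
    {f : Ω → List (Outcome N) → ℝ≥0∞}
    (hf : ∀ h : List (Outcome N), h.length ≤ T → Measurable fun ω => f ω h) (k : ℕ) :
    ∀ h : List (Outcome N), h.length + k ≤ T → Measurable fun ω => agentMean A G ω (f ω) k h := by
  induction k with
  | zero => exact fun h hh => hf h hh
  | succ k ih =>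
    intro h hh
    refine Finset.measurable_sum _ fun o _ => Measurable.mul ?_ (ih _ ?_)
    · exact (measurable_choiceProb hA hQ hmentor hinput h (by omega) o).mono (𝓕.le _) le_rfl
    · rw [List.length_cons]; omega

theorem measurable_totalLoss (hA : A.expert = fun i => policyExpert (Q i))
    (hQ : ∀ i, Measurable (Q i)) (hmentor : Measurable G.mentor)
    (hinput : ∀ h : List (Outcome N), h.length < T →
      Measurable[𝓕 (h.length + 1)] fun ω => G.input ω h) (i : Fin N)
    (h : List (Outcome N)) (hh : h.length ≤ T) : Measurable fun ω => totalLoss A G ω i h := by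
  induction h with
  | nil => exact measurable_const
  | cons o h ih =>
    exact ((measurable_lossAt hA hQ hmentor (hinput h hh) i).mono (𝓕.le _) le_rfl).add
      (ih (Nat.le_of_succ_le hh))

/-- If, conditionally on the past, an input falls into the region where policy `i` disagrees with
the mentor with probability at most `c`, then `k` rounds add at most `k c` to the expected loss of
that policy. The weight `ρ` stands for the probability of the history, which depends on the
adversary's randomization. -/
theorem lintegral_mul_agentMean_totalLoss_le {P : Measure Ω} [IsProbabilityMeasure P] {c : ℝ≥0∞}
    (hN : 0 < N) (hp0 : 0 ≤ A.p) (hp1 : A.p ≤ 1)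
    (hA : A.expert = fun i => policyExpert (Q i))
    (hQ : ∀ i, Measurable (Q i)) (hmentor : Measurable G.mentor)
    (hinput : ∀ h : List (Outcome N), h.length < T →
      Measurable[𝓕 (h.length + 1)] fun ω => G.input ω h) (i : Fin N)
    (hc : ∀ h : List (Outcome N), h.length < T → ∀ B, MeasurableSet[𝓕 h.length] B →
      P (B ∩ {ω | G.input ω h ∈ {x | Q i x ≠ G.mentor x}}) ≤ c * P B) (k : ℕ) :
    ∀ (h : List (Outcome N)) (ρ : Ω → ℝ≥0∞), h.length + k ≤ T → Measurable[𝓕 h.length] ρ →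
      ∫⁻ ω, ρ ω * agentMean A G ω (fun h => ENNReal.ofReal (totalLoss A G ω i h)) k h ∂P ≤
        ∫⁻ ω, ρ ω * (ENNReal.ofReal (totalLoss A G ω i h) + k * c) ∂P := by
  have hf : ∀ h : List (Outcome N), h.length ≤ T →
      Measurable fun ω => ENNReal.ofReal (totalLoss A G ω i h) := fun h hh =>
    (measurable_totalLoss hA hQ hmentor hinput i h hh).ennreal_ofReal
  induction k with
  | zero => intro h ρ _ _; simp [agentMean]
  | succ k ih =>
    intro h ρ hh hρ
    have hρ' : Measurable ρ := hρ.mono (𝓕.le _) le_rfl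
    have hch : ∀ o, Measurable[𝓕 h.length] fun ω => choiceProb A (stateAfter A G ω h) o := fun o =>
      measurable_choiceProb hA hQ hmentor hinput h (by omega) o
    have hch' : ∀ o, Measurable fun ω => choiceProb A (stateAfter A G ω h) o := fun o =>
      (hch o).mono (𝓕.le _) le_rfl
    have hE : MeasurableSet {ω | G.input ω h ∈ {x | Q i x ≠ G.mentor x}} :=
      G.measurable_input h (by omega) (measurableSet_disagreement hQ hmentor i)
    have hloss : ∀ ω, ENNReal.ofReal (lossAt A G ω h i) =
        Set.indicator {ω | G.input ω h ∈ {x | Q i x ≠ G.mentor x}} (fun _ => 1) ω := by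
      intro ω
      rw [lossAt_policyExpert hA]
      by_cases h' : Q i (G.input ω h) = G.mentor (G.input ω h) <;> simp [Set.indicator, h']
    have hround : ∫⁻ ω, ρ ω * ENNReal.ofReal (lossAt A G ω h i) ∂P ≤ c * ∫⁻ ω, ρ ω ∂P := by
      refine le_trans (le_of_eq ?_)
        (setLIntegral_le_mul_of_forall_inter_le (𝓕.le _) c (hc h (by omega)) hρ)
      rw [← lintegral_indicator hE]
      refine lintegral_congr fun ω => ?_
      rw [hloss]
      by_cases h' : ω ∈ {ω | G.input ω h ∈ {x | Q i x ≠ G.mentor x}}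
      · simp only [Set.indicator_of_mem h', mul_one]
      · simp only [Set.indicator_of_notMem h', mul_zero]
    have hmul : ∀ o, Measurable fun ω => ρ ω * choiceProb A (stateAfter A G ω h) o := fun o =>
      hρ'.mul (hch' o)
    have hsum : Measurable fun ω => ρ ω * (ENNReal.ofReal (totalLoss A G ω i h) + k * c) :=
      hρ'.mul ((hf h (by omega)).add_const _)
    calc ∫⁻ ω, ρ ω * agentMean A G ω (fun h => ENNReal.ofReal (totalLoss A G ω i h)) (k + 1) h ∂P
        = ∑ o, ∫⁻ ω, (ρ ω * choiceProb A (stateAfter A G ω h) o) *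
            agentMean A G ω (fun h => ENNReal.ofReal (totalLoss A G ω i h)) k (o :: h) ∂P := by
          rw [← lintegral_finsetSum]
          · refine lintegral_congr fun ω => ?_
            simp only [agentMean, Finset.mul_sum, mul_assoc]
          · exact fun o _ => (hmul o).mul (measurable_agentMean hA hQ hmentor hinput hf k (o :: h)
              (by rw [List.length_cons]; omega))
      _ ≤ ∑ o, ∫⁻ ω, (ρ ω * choiceProb A (stateAfter A G ω h) o) *
            (ENNReal.ofReal (totalLoss A G ω i (o :: h)) + k * c) ∂P := by
          refine Finset.sum_le_sum fun o _ => ih (o :: h) _ (by rw [List.length_cons]; omega) ?_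
          exact (hρ.mul (hch o)).mono (𝓕.mono (Nat.le_succ _)) le_rfl
      _ = ∫⁻ ω, (ρ ω * (ENNReal.ofReal (totalLoss A G ω i h) + k * c) +
            ρ ω * ENNReal.ofReal (lossAt A G ω h i)) ∂P := by
          rw [← lintegral_finsetSum]
          · refine lintegral_congr fun ω => ?_
            have e : ∀ o, ENNReal.ofReal (totalLoss A G ω i (o :: h)) =
                ENNReal.ofReal (lossAt A G ω h i) + ENNReal.ofReal (totalLoss A G ω i h) :=
              fun o => ENNReal.ofReal_add (lossAt_nonneg h i) (totalLoss_nonneg i h)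
            simp only [e]
            rw [← Finset.sum_mul, ← Finset.mul_sum, sum_choiceProb hN hp0 hp1]
            ring
          · exact fun o _ => (hmul o).mul ((hf (o :: h)
              (by rw [List.length_cons]; omega)).add_const _)
      _ ≤ ∫⁻ ω, ρ ω * (ENNReal.ofReal (totalLoss A G ω i h) + k * c) ∂P + c * ∫⁻ ω, ρ ω ∂P := by
          rw [lintegral_add_left hsum]
          gcongr
      _ = ∫⁻ ω, ρ ω * (ENNReal.ofReal (totalLoss A G ω i h) + (k + 1 : ℕ) * c) ∂P := by
          rw [← lintegral_const_mul _ hρ',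
            ← lintegral_add_left hsum]
          refine lintegral_congr fun ω => ?_
          push_cast
          ring

theorem SmoothInputs.le_one {P : Measure Ω} [IsProbabilityMeasure P] {U : Measure X}
    [IsProbabilityMeasure U] {σ : ℝ} (hG : SmoothInputs P U σ G) (hσ : 0 < σ) (hT : 0 < T) :
    σ ≤ 1 := by
  obtain ⟨𝓕, D, hD⟩ := hG
  have : Nonempty Ω := by
    by_contra hX
    rw [not_nonempty_iff] at hX
    exact IsProbabilityMeasure.ne_zero P (Measure.eq_zero_of_isEmpty P)
  obtain ⟨h1, h2⟩ := (hD [] hT).2.1 (Classical.arbitrary Ω)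
  have h3 := h2 Set.univ MeasurableSet.univ
  rw [measure_univ, measure_univ, ENNReal.le_div_iff_mul_le (by simp [hσ]) (by simp), one_mul] at h3
  exact ENNReal.ofReal_le_one.1 h3

theorem lintegral_agentMean_totalLoss_le {P : Measure Ω} [IsProbabilityMeasure P] {U : Measure X}
    {σ ε : ℝ} (hσ : 0 < σ) (hN : 0 < N) (hp0 : 0 ≤ A.p) (hp1 : A.p ≤ 1)
    (hA : A.expert = fun i => policyExpert (Q i))
    (hQ : ∀ i, Measurable (Q i)) (hmentor : Measurable G.mentor) (i : Fin N)
    (hi : U {x | Q i x ≠ G.mentor x} ≤ ENNReal.ofReal ε) (hG : SmoothInputs P U σ G) :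
    (Measurable fun ω => agentMean A G ω (fun h => ENNReal.ofReal (totalLoss A G ω i h)) T []) ∧
    ∫⁻ ω, agentMean A G ω (fun h => ENNReal.ofReal (totalLoss A G ω i h)) T [] ∂P ≤
      ENNReal.ofReal (T * (ε / σ)) := by
  obtain ⟨𝓕, D, hD⟩ := hG
  refine ⟨measurable_agentMean (𝓕 := 𝓕) hA hQ hmentor (fun h hh => (hD h hh).2.2.1)
    (fun h hh => (measurable_totalLoss hA hQ hmentor (fun h hh => (hD h hh).2.2.1) i h
      hh).ennreal_ofReal) T [] (by simp), ?_⟩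
  have h1 := lintegral_mul_agentMean_totalLoss_le (P := P) (𝓕 := 𝓕) (c := ENNReal.ofReal (ε / σ))
    hN hp0 hp1 hA hQ hmentor (fun h hh => (hD h hh).2.2.1) i (fun h hh B hB => by
      rw [(hD h hh).2.2.2 B hB _ (measurableSet_disagreement hQ hmentor i)]
      calc ∫⁻ ω in B, D h ω {x | Q i x ≠ G.mentor x} ∂P
          ≤ ∫⁻ ω in B, ENNReal.ofReal (ε / σ) ∂P := by
            refine lintegral_mono fun ω => ?_
            refine (((hD h hh).2.1 ω).2 _ (measurableSet_disagreement hQ hmentor i)).trans ?_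
            rw [ENNReal.ofReal_div_of_pos hσ]
            gcongr
        _ = _ := by rw [setLIntegral_const]) T [] (fun _ => 1) (by simp) measurable_const
  simp only [one_mul] at h1
  refine h1.trans (le_of_eq ?_)
  have h2 : ∀ ω, totalLoss A G ω i [] = 0 := fun _ => rfl
  simp only [h2, ENNReal.ofReal_zero, zero_add, lintegral_const, measure_univ, mul_one]
  rw [ENNReal.ofReal_mul (by positivity), ENNReal.ofReal_natCast]

end Smooth


/-! ### Regret and queries along a run -/

section Path

variable {X : Type*} [PseudoMetricSpace X] [MeasurableSpace X] {N : ℕ} {Ω : Type*}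
  [MeasurableSpace Ω] {T : ℕ} {L μmin : ℝ} {A : Params X N} {G : Environment X N Ω T L μmin} {ω : Ω}

theorem snd_eq_mentor_of_mem_S (h : List (Outcome N)) :
    ∀ z ∈ (stateAfter A G ω h).S, z.2 = G.mentor z.1 := by
  induction h with
  | nil => simp [stateAfter, AgentState.init]
  | cons o h ih =>
    intro z hz
    simp only [stateAfter, nextState] at hz
    split at hz
    · rcases hz with rfl | hz
      · rfl
      · exact ih z hz
    · exact ih z hz

/-- The agent's loss in a round: if it follows an expert that is wrong, then the proposed
action was the mentor's action on an input within `radius`. -/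
theorem mentor_sub_agent_payoff_le (hL : 0 ≤ L) (hr : 0 ≤ A.radius) (h : List (Outcome N))
    (hh : h.length < T) (o : Outcome N) :
    G.payoff ω h (G.input ω h) (G.mentor (G.input ω h)) -
      G.payoff ω h (G.input ω h) ((actionAt A G ω h o).getD (G.mentor (G.input ω h))) ≤
      L * A.radius * wrongAt A G ω h o := by
  cases hact : actionAt A G ω h o with
  | none =>
    rw [Option.getD_none, sub_self]
    exact mul_nonneg (mul_nonneg hL hr) (wrongAt_nonneg h o)
  | some b =>
    rw [Option.getD_some]
    obtain _ | i := o
    · simp [actionAt, action] at hact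
    · simp only [actionAt, action] at hact
      split_ifs at hact with hfar
      obtain rfl := Option.some.inj hact
      by_cases hb : A.expert i (stateAfter A G ω h).past (G.input ω h) = G.mentor (G.input ω h)
      · rw [hb, sub_self]
        exact mul_nonneg (mul_nonneg hL hr) (wrongAt_nonneg h _)
      · push Not at hfar
        obtain ⟨z, hz, hzb, hzr⟩ := hfar
        have hw : wrongAt A G ω h (some i) = 1 := by simp [wrongAt, lossAt, loss, hb]
        rw [hw, mul_one, ← hzb, snd_eq_mentor_of_mem_S h z hz]
        calc _ ≤ L * dist (G.input ω h) z.1 :=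
              (le_abs_self _).trans (G.local_generalization ω h hh _ _)
          _ ≤ L * A.radius := by gcongr

theorem addRegret_le (hL : 0 ≤ L) (hr : 0 ≤ A.radius) (h : List (Outcome N)) (hh : h.length ≤ T) :
    addRegret A G ω h ≤ L * A.radius * wrongSamples A G ω h := by
  induction h with
  | nil => simp [addRegret, mentorPayoffs, agentPayoffs, wrongSamples, historySum]
  | cons o h ih =>
    have h1 := ih (Nat.le_of_succ_le hh)
    have h2 := mentor_sub_agent_payoff_le (A := A) (G := G) (ω := ω) hL hr h hh o
    rw [wrongSamples_cons, mul_add]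
    simp only [addRegret, mentorPayoffs, agentPayoffs, List.sum_cons] at h1 ⊢
    linarith

/-- Every payoff of the agent is at least `μmin / 2`, so the logarithms are those of positive
numbers and `log (m / a) ≤ (m - a) / a` bounds the multiplicative loss of a round. -/
theorem log_payoffs_le (hL : 0 ≤ L) (hr : 0 ≤ A.radius) (hμ : 0 < μmin)
    (hLr : L * A.radius ≤ μmin / 2) (h : List (Outcome N)) (hh : h.length ≤ T) :
    (mentorPayoffs G ω h).prod ≠ 0 ∧ (0 : ℝ) ∉ agentPayoffs A G ω h ∧
      Real.log (mentorPayoffs G ω h).prod - Real.log (agentPayoffs A G ω h).prod ≤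
        2 * L * A.radius / μmin * wrongSamples A G ω h := by
  induction h with
  | nil => simp [mentorPayoffs, agentPayoffs, wrongSamples, historySum]
  | cons o h ih =>
    obtain ⟨h1, h2, h3⟩ := ih (Nat.le_of_succ_le hh)
    have h4 := mentor_sub_agent_payoff_le (A := A) (G := G) (ω := ω) hL hr h hh o
    have h5 := G.mentor_payoff ω h hh
    rw [wrongSamples_cons, mul_add]
    simp only [mentorPayoffs, agentPayoffs, List.prod_cons, List.mem_cons, not_or]
    set m := G.payoff ω h (G.input ω h) (G.mentor (G.input ω h))
    set a := G.payoff ω h (G.input ω h) ((actionAt A G ω h o).getD (G.mentor (G.input ω h)))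
    have hw0 := wrongAt_nonneg (A := A) (G := G) (ω := ω) h o
    have hw1 := wrongAt_le_one (A := A) (G := G) (ω := ω) h o
    have hLr0 : 0 ≤ L * A.radius := mul_nonneg hL hr
    have hm : 0 < m := hμ.trans_le h5
    have ha : μmin / 2 ≤ a := by nlinarith
    have ha0 : 0 < a := by linarith
    refine ⟨mul_ne_zero hm.ne' h1, ⟨ha0.ne, h2⟩, ?_⟩
    rw [Real.log_mul hm.ne' h1, Real.log_mul ha0.ne' (List.prod_ne_zero h2)]
    have h6 : Real.log m - Real.log a ≤ 2 * L * A.radius / μmin * wrongAt A G ω h o := by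
      rw [← Real.log_div hm.ne' ha0.ne']
      calc Real.log (m / a) ≤ m / a - 1 := Real.log_le_sub_one_of_pos (by positivity)
        _ = (m - a) / a := by field_simp
        _ ≤ L * A.radius * wrongAt A G ω h o / a := by gcongr
        _ ≤ L * A.radius * wrongAt A G ω h o / (μmin / 2) := by gcongr
        _ = _ := by field_simp
    linarith

theorem mulRegret_le (hL : 0 ≤ L) (hr : 0 ≤ A.radius) (hμ : 0 < μmin)
    (hLr : L * A.radius ≤ μmin / 2) (h : List (Outcome N)) (hh : h.length ≤ T) :
    mulRegret A G ω h ≤ ((2 * L * A.radius / μmin * wrongSamples A G ω h : ℝ) : EReal) := by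
  obtain ⟨-, h1, h2⟩ := log_payoffs_le (A := A) (G := G) (ω := ω) hL hr hμ hLr h hh
  rw [mulRegret, if_neg h1]
  exact EReal.coe_le_coe h2

/-- The number of Hedge queries in the history. -/
noncomputable def hedgeQueries {N : ℕ} : List (Outcome N) → ℝ :=
  historySum fun _ o => match o with
    | none => 1
    | some _ => 0

theorem hedgeQueries_nonneg (h : List (Outcome N)) : 0 ≤ hedgeQueries h :=
  historySum_nonneg (fun h o => by cases o <;> simp) h

theorem agentMeanReal_hedgeQueries (hN : 0 < N) (k : ℕ) :
    ∀ h, agentMeanReal A G ω hedgeQueries k h = hedgeQueries h + k * A.p := by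
  induction k with
  | zero => intro h; simp [agentMeanReal]
  | succ k ih =>
    intro h
    have e1 : hedgeQueries ((none : Outcome N) :: h) = 1 + hedgeQueries h := rfl
    have e2 : ∀ i : Fin N, hedgeQueries (some i :: h) = 0 + hedgeQueries h := fun _ => rfl
    rw [agentMeanReal]
    simp only [ih]
    rw [sum_choiceReal_mul, e1]
    simp only [e2]
    rw [← Finset.sum_mul, sum_weight_div hN]
    push_cast
    ring

/-- The queries that are neither Hedge queries nor due to a wrong sample add inputs to `S` that are
far from the earlier ones with the same label. -/
theorem exists_separated_numQueries_le (hr : 0 ≤ A.radius) (h : List (Outcome N)) :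
    ∃ F : Bool → Finset X,
      (∀ b, ∀ x ∈ F b, (x, b) ∈ (stateAfter A G ω h).S ∧ x ∈ inputs G ω h) ∧
      (∀ b, ∀ x ∈ F b, ∀ y ∈ F b, x ≠ y → A.radius < dist x y) ∧
      (numQueries A G ω h : ℝ) ≤ hedgeQueries h + wrongSamples A G ω h +
        ((F true).card + (F false).card) := by
  classical
  induction h with
  | nil => exact ⟨fun _ => ∅, by simp, by simp,
      by simp [numQueries, hedgeQueries, wrongSamples, historySum]⟩
  | cons o h ih =>
    obtain ⟨F, hF1, hF2, hF3⟩ := ih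
    have hS : (stateAfter A G ω h).S ⊆ (stateAfter A G ω (o :: h)).S := by
      simp only [stateAfter, nextState]
      split
      · exact Set.subset_insert _ _
      · exact subset_rfl
    have hF1' : ∀ b, ∀ x ∈ F b,
        (x, b) ∈ (stateAfter A G ω (o :: h)).S ∧ x ∈ inputs G ω (o :: h) := fun b x hx =>
      ⟨hS (hF1 b x hx).1, List.mem_cons_of_mem _ (hF1 b x hx).2⟩
    rw [wrongSamples_cons]
    have hw0 := wrongAt_nonneg (A := A) (G := G) (ω := ω) h o
    obtain _ | i := o
    · refine ⟨F, hF1', hF2, ?_⟩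
      have e1 : hedgeQueries ((none : Outcome N) :: h) = 1 + hedgeQueries h := rfl
      have e2 : numQueries A G ω (none :: h) = 1 + numQueries A G ω h := rfl
      rw [e1, e2]
      push_cast
      linarith
    · have e1 : hedgeQueries (some i :: h) = 0 + hedgeQueries h := rfl
      rw [e1]
      by_cases hact : actionAt A G ω h (some i) = none
      · have e2 : numQueries A G ω (some i :: h) = 1 + numQueries A G ω h := by
          simp [numQueries, hact]
        rw [e2]
        push_cast
        by_cases hb : A.expert i (stateAfter A G ω h).past (G.input ω h) = G.mentor (G.input ω h)
        -- the input is far from all earlier ones with the mentor's label, and receives that label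
        · set x := G.input ω h with hx
          set m := G.mentor x with hm
          have hfar : ∀ z ∈ (stateAfter A G ω h).S, z.2 = m → A.radius < dist x z.1 := by
            by_contra hcon
            rw [← hb] at hcon
            simp only [actionAt, action] at hact
            rw [if_neg hcon] at hact
            simp at hact
          have hxF : x ∉ F m := by
            intro hxF
            have := hfar _ (hF1 m x hxF).1 rfl
            rw [dist_self] at this
            linarith
          have hSx : (x, m) ∈ (stateAfter A G ω (some i :: h)).S := by
            have hact' : action A (stateAfter A G ω h) (G.input ω h) (some i) = none := hact
            simp only [stateAfter, nextState, hact']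
            exact Set.mem_insert _ _
          refine ⟨Function.update F m (insert x (F m)), fun b y hy => ?_, fun b y hy z hz hyz => ?_,
            ?_⟩
          · by_cases hbm : b = m
            · subst hbm
              rw [Function.update_self, Finset.mem_insert] at hy
              rcases hy with rfl | hy
              · exact ⟨hSx, List.mem_cons_self⟩
              · exact hF1' _ y hy
            · rw [Function.update_of_ne hbm] at hy
              exact hF1' b y hy
          · by_cases hbm : b = m
            · subst hbm
              rw [Function.update_self, Finset.mem_insert] at hy hz
              rcases hy with rfl | hy <;> rcases hz with rfl | hz
              · exact absurd rfl hyz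
              · exact hfar _ (hF1 _ z hz).1 rfl
              · rw [dist_comm]; exact hfar _ (hF1 _ y hy).1 rfl
              · exact hF2 _ y hy z hz hyz
            · rw [Function.update_of_ne hbm] at hy hz
              exact hF2 b y hy z hz hyz
          · have hcard : ((Function.update F m (insert x (F m)) true).card : ℝ) +
                (Function.update F m (insert x (F m)) false).card =
                (F true).card + (F false).card + 1 := by
              have hins : ((insert x (F m)).card : ℝ) = (F m).card + 1 := by
                rw [Finset.card_insert_of_notMem hxF]; push_cast; ring
              clear_value m
              cases m
              · rw [Function.update_self, Function.update_of_ne (by simp), hins]; ring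
              · rw [Function.update_self, Function.update_of_ne (by simp), hins]; ring
            rw [hcard]
            linarith
          -- a query in a round with a wrong sample
        · refine ⟨F, hF1', hF2, ?_⟩
          have hw : wrongAt A G ω h (some i) = 1 := by simp [wrongAt, lossAt, loss, hb]
          rw [hw]
          linarith
      · refine ⟨F, hF1', hF2, ?_⟩
        have e2 : numQueries A G ω (some i :: h) = numQueries A G ω h := by
          simp [numQueries, hact]
        rw [e2]
        linarith

end Path

/-! ### Separated sets in Euclidean space -/

/-- The points of an `r`-separated set lie in different cells of the grid of mesh `r / n`. -/
theorem card_le_of_separated_euclidean {n : ℕ} (hn : 1 ≤ n) {r D : ℝ} (hr : 0 < r) (hD : 0 ≤ D)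
    (F : Finset (EuclideanSpace ℝ (Fin n)))
    (hsep : ∀ x ∈ F, ∀ y ∈ F, x ≠ y → r < dist x y) (hdiam : ∀ x ∈ F, ∀ y ∈ F, dist x y ≤ D) :
    (F.card : ℝ) ≤ (4 * n) ^ n * (1 + D ^ n / r ^ n) := by
  have hn0 : (1 : ℝ) ≤ n := by exact_mod_cast hn
  have hrhs : 0 ≤ (4 * n : ℝ) ^ n * (1 + D ^ n / r ^ n) := by positivity
  obtain rfl | ⟨y₀, hy₀⟩ := F.eq_empty_or_nonempty
  · simpa using hrhs
  set a : ℝ := n * D / r with ha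
  have ha0 : 0 ≤ a := by positivity
  have hcoord : ∀ (x y : EuclideanSpace ℝ (Fin n)) i, |x i - y i| ≤ dist x y := by
    intro x y i
    rw [dist_eq_norm, ← Real.norm_eq_abs]
    exact PiLp.norm_apply_le (x - y) i
  let cell : EuclideanSpace ℝ (Fin n) → Fin n → ℤ := fun x i => ⌊(x i - y₀ i) * (n / r)⌋
  have hmaps : ∀ x ∈ F, cell x ∈ Fintype.piFinset fun _ : Fin n => Finset.Icc ⌊-a⌋ ⌊a⌋ := by
    intro x hx
    rw [Fintype.mem_piFinset]
    intro i
    have h1 : |(x i - y₀ i) * (n / r)| ≤ a := by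
      rw [abs_mul, abs_of_pos (by positivity : (0 : ℝ) < n / r)]
      calc |x i - y₀ i| * (n / r) ≤ D * (n / r) := by
            gcongr
            exact (hcoord x y₀ i).trans (hdiam x hx y₀ hy₀)
        _ = a := by rw [ha]; ring
    obtain ⟨h2, h3⟩ := abs_le.1 h1
    exact Finset.mem_Icc.2 ⟨Int.floor_le_floor h2, Int.floor_le_floor h3⟩
  have hinj : Set.InjOn cell F := by
    intro x hx y hy hxy
    by_contra hne
    have h1 := hsep x hx y hy hne
    have h2 : ∀ i, dist (x i) (y i) ^ 2 ≤ (r / n) ^ 2 := by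
      intro i
      have h3 : |(x i - y₀ i) * (n / r) - (y i - y₀ i) * (n / r)| < 1 :=
        Int.abs_sub_lt_one_of_floor_eq_floor (congrFun hxy i)
      rw [← sub_mul, sub_sub_sub_cancel_right, abs_mul,
        abs_of_pos (by positivity : (0 : ℝ) < n / r)] at h3
      have h4 : |x i - y i| ≤ r / n := by
        rw [le_div_iff₀ (by positivity)]
        rw [← mul_div_assoc, div_lt_one hr] at h3
        exact h3.le
      rw [Real.dist_eq]
      gcongr
    have h5 : dist x y ≤ r := by
      rw [EuclideanSpace.dist_eq]
      refine Real.sqrt_le_iff.2 ⟨hr.le, (Finset.sum_le_sum fun i _ => h2 i).trans ?_⟩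
      rw [Finset.sum_const, Finset.card_univ, Fintype.card_fin, nsmul_eq_mul]
      calc (n : ℝ) * (r / n) ^ 2 = r ^ 2 / n := by field_simp
        _ ≤ r ^ 2 / 1 := by gcongr
        _ = r ^ 2 := by ring
    linarith
  have hcard := Finset.card_le_card_of_injOn cell hmaps hinj
  rw [Fintype.card_piFinset_const, Int.card_Icc] at hcard
  have hint : ((⌊a⌋ + 1 - ⌊-a⌋).toNat : ℝ) ≤ 2 * (a + 1) := by
    have h1 : 0 ≤ ⌊a⌋ + 1 - ⌊-a⌋ := by
      have := Int.floor_le_floor (show -a ≤ a by linarith)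
      omega
    have h2 : ((⌊a⌋ + 1 - ⌊-a⌋).toNat : ℝ) = ((⌊a⌋ + 1 - ⌊-a⌋ : ℤ) : ℝ) := by
      exact_mod_cast congrArg (Int.cast : ℤ → ℝ) (Int.toNat_of_nonneg h1)
    rw [h2]
    push_cast
    linarith [Int.floor_le a, Int.lt_floor_add_one (-a)]
  calc (F.card : ℝ) ≤ ((⌊a⌋ + 1 - ⌊-a⌋).toNat : ℝ) ^ n := by exact_mod_cast hcard
    _ ≤ (2 * (a + 1)) ^ n := by gcongr
    _ ≤ (4 * max a 1) ^ n := by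
        refine pow_le_pow_left₀ (by positivity) ?_ n
        linarith [le_max_left a 1, le_max_right a 1]
    _ = 4 ^ n * (max a 1) ^ n := by rw [mul_pow]
    _ ≤ 4 ^ n * (1 + a ^ n) := by
        gcongr
        rcases max_choice a 1 with h | h <;> rw [h]
        · linarith
        · rw [one_pow]; linarith [pow_nonneg ha0 n]
    _ ≤ 4 ^ n * (n ^ n + a ^ n) := by
        gcongr
        exact one_le_pow₀ hn0
    _ = (4 * n) ^ n * (1 + D ^ n / r ^ n) := by
        rw [ha, div_pow, mul_pow, mul_pow]
        ring

theorem numQueries_le {n : ℕ} (hn : 1 ≤ n) {X : Set (EuclideanSpace ℝ (Fin n))} {N : ℕ} {Ω : Type*}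
    [MeasurableSpace Ω] {T : ℕ} {L μmin : ℝ} {A : Params X N} {G : Environment X N Ω T L μmin}
    {ω : Ω} (hr : 0 < A.radius) (h : List (Outcome N)) :
    (numQueries A G ω h : ℝ) ≤ hedgeQueries h + wrongSamples A G ω h +
      2 * ((4 * n) ^ n * (1 + Metric.diam {x | x ∈ inputs G ω h} ^ n / A.radius ^ n)) := by
  obtain ⟨F, h1, h2, h3⟩ := exists_separated_numQueries_le (A := A) (G := G) (ω := ω) hr.le h
  have hbdd : Bornology.IsBounded {x | x ∈ inputs G ω h} :=
    (List.finite_toSet (inputs G ω h)).isBounded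
  have h4 : ∀ b, ((F b).card : ℝ) ≤
      (4 * n) ^ n * (1 + Metric.diam {x | x ∈ inputs G ω h} ^ n / A.radius ^ n) := by
    intro b
    rw [← Finset.card_map (Function.Embedding.subtype (· ∈ X))]
    refine card_le_of_separated_euclidean hn hr Metric.diam_nonneg _ ?_ ?_
    · intro x hx y hy hxy
      obtain ⟨x, hx', rfl⟩ := Finset.mem_map.1 hx
      obtain ⟨y, hy', rfl⟩ := Finset.mem_map.1 hy
      exact h2 b x hx' y hy' fun e => hxy (by rw [e])
    · intro x hx y hy
      obtain ⟨x, hx', rfl⟩ := Finset.mem_map.1 hx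
      obtain ⟨y, hy', rfl⟩ := Finset.mem_map.1 hy
      exact Metric.dist_le_diam_of_mem hbdd (h1 b x hx').2 (h1 b y hy').2
  linarith [h4 true, h4 false]


/-! ### The choice of the parameters -/

section Parameters

variable {n T : ℕ}

theorem accuracy_pos (hT : 2 ≤ T) : 0 < accuracy n T :=
  Real.rpow_pos_of_pos (by exact_mod_cast (by omega : 0 < T)) _

theorem accuracy_le_one (hT : 1 ≤ T) : accuracy n T ≤ 1 := by
  refine Real.rpow_le_one_of_one_le_of_nonpos (by exact_mod_cast hT) ?_
  exact div_nonpos_of_nonpos_of_nonneg (neg_nonpos.2 (by positivity)) (by positivity)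

theorem accuracy_mul (hT : 2 ≤ T) : accuracy n T * T = (T : ℝ) ^ (1 / (2 * n + 1) : ℝ) := by
  have hT0 : (0 : ℝ) < T := by exact_mod_cast (by omega : 0 < T)
  rw [accuracy, ← Real.rpow_add_one hT0.ne']
  congr 1
  field_simp
  ring

theorem one_le_accuracy_mul (hT : 2 ≤ T) : 1 ≤ accuracy n T * T := by
  rw [accuracy_mul hT]
  exact Real.one_le_rpow (by exact_mod_cast (by omega : 1 ≤ T)) (by positivity)

theorem accuracy_rpow_pow (hn : 1 ≤ n) (hT : 2 ≤ T) :
    (accuracy n T ^ (1 / (n : ℝ))) ^ n = accuracy n T := by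
  rw [one_div]
  exact Real.rpow_inv_natCast_pow (accuracy_pos hT).le (by omega)

theorem accuracy_mul_mul_rpow (hn : 1 ≤ n) (hT : 2 ≤ T) :
    accuracy n T * T * accuracy n T ^ (1 / (n : ℝ)) = (T : ℝ) ^ (-1 / (2 * n + 1) : ℝ) := by
  have hT0 : (0 : ℝ) < T := by exact_mod_cast (by omega : 0 < T)
  have hn0 : (n : ℝ) ≠ 0 := by exact_mod_cast (by omega : n ≠ 0)
  rw [accuracy_mul hT, accuracy, ← Real.rpow_mul hT0.le, ← Real.rpow_add hT0]
  congr 1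
  field_simp
  ring

theorem inv_accuracy_le (hT : 2 ≤ T) :
    1 / accuracy n T ≤ (T : ℝ) ^ ((4 * n + 1) / (4 * n + 2) : ℝ) := by
  have hT1 : (1 : ℝ) ≤ T := by exact_mod_cast (by omega : 1 ≤ T)
  rw [accuracy, one_div, ← Real.rpow_neg (by linarith)]
  refine Real.rpow_le_rpow_of_exponent_le hT1 ?_
  rw [neg_div, neg_neg, div_le_div_iff₀ (by positivity) (by positivity)]
  nlinarith

theorem accuracy_mul_le (hn : 1 ≤ n) (hT : 2 ≤ T) :
    accuracy n T * T ≤ (T : ℝ) ^ ((4 * n + 1) / (4 * n + 2) : ℝ) := by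
  have hT1 : (1 : ℝ) ≤ T := by exact_mod_cast (by omega : 1 ≤ T)
  rw [accuracy_mul hT]
  refine Real.rpow_le_rpow_of_exponent_le hT1 ?_
  rw [div_le_div_iff₀ (by positivity) (by positivity)]
  have : (1 : ℝ) ≤ n := by exact_mod_cast hn
  nlinarith

theorem mul_queryProb (hT : 2 ≤ T) :
    T * (1 / √(accuracy n T * T)) = (T : ℝ) ^ ((4 * n + 1) / (4 * n + 2) : ℝ) := by
  have hT0 : (0 : ℝ) < T := by exact_mod_cast (by omega : 0 < T)
  rw [accuracy_mul hT, Real.sqrt_eq_rpow, ← Real.rpow_mul hT0.le, one_div ((T : ℝ) ^ _),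
    ← Real.rpow_neg hT0.le]
  nth_rewrite 1 [← Real.rpow_one (T : ℝ)]
  rw [← Real.rpow_add hT0]
  congr 1
  field_simp
  ring

theorem one_le_two_mul_log (hT : 2 ≤ T) : 1 ≤ 2 * Real.log T := by
  have h1 : Real.log 2 ≤ Real.log T := Real.log_le_log (by norm_num) (by exact_mod_cast hT)
  linarith [Real.log_two_gt_d9]

variable {N d : ℕ}

theorem log_card_le_of_smooth (hT : 2 ≤ T) (hN : 0 < N)
    (h : (N : ℝ) ≤ (41 / accuracy n T) ^ d) : Real.log N ≤ 7 * (d * Real.log T) := by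
  have hT1 : (1 : ℝ) ≤ T := by exact_mod_cast (by omega : 1 ≤ T)
  have hε := accuracy_pos (n := n) hT
  have h1 : 1 / accuracy n T ≤ T := by
    rw [div_le_iff₀ hε, mul_comm]
    exact one_le_accuracy_mul hT
  have h2 : Real.log 41 ≤ 6 * Real.log 2 := by
    rw [← Real.log_rpow (by norm_num)]
    exact Real.log_le_log (by norm_num) (by norm_num)
  have h3 : Real.log 2 ≤ Real.log T := Real.log_le_log (by norm_num) (by exact_mod_cast hT)
  calc Real.log N ≤ Real.log ((41 / accuracy n T) ^ d) :=
        Real.log_le_log (by exact_mod_cast hN) h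
    _ = d * Real.log (41 / accuracy n T) := Real.log_pow _ _
    _ ≤ d * Real.log (41 * T) := by
        gcongr
        calc 41 / accuracy n T = 41 * (1 / accuracy n T) := by ring
          _ ≤ 41 * T := by gcongr
    _ = d * (Real.log 41 + Real.log T) := by rw [Real.log_mul (by norm_num) (by linarith)]
    _ ≤ d * (7 * Real.log T) := by gcongr; linarith
    _ = _ := by ring

theorem log_card_le_of_littlestone (hT : 2 ≤ T) (hd : 1 ≤ d) (hN : 0 < N)
    (h : (N : ℝ) ≤ (Real.exp 1 * T / d) ^ d) : Real.log N ≤ 7 * (d * Real.log T) := by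
  have hT1 : (1 : ℝ) ≤ T := by exact_mod_cast (by omega : 1 ≤ T)
  have hd1 : (1 : ℝ) ≤ d := by exact_mod_cast hd
  have h1 := one_le_two_mul_log hT
  calc Real.log N ≤ Real.log ((Real.exp 1 * T / d) ^ d) :=
        Real.log_le_log (by exact_mod_cast hN) h
    _ = d * Real.log (Real.exp 1 * T / d) := Real.log_pow _ _
    _ ≤ d * Real.log (Real.exp 1 * T) := by
        gcongr
        exact div_le_self (by positivity) hd1
    _ = d * (1 + Real.log T) := by
        rw [Real.log_mul (Real.exp_ne_zero _) (by linarith), Real.log_exp]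
    _ ≤ d * (7 * Real.log T) := by gcongr; linarith
    _ = _ := by ring

theorem algorithm_p_pos {X : Type*} {E : Fin N → Expert X} (hT : 2 ≤ T) :
    0 < (algorithm n T (accuracy n T) E).p :=
  one_div_pos.2 (Real.sqrt_pos.2 (by linarith [one_le_accuracy_mul (n := n) hT]))

theorem algorithm_p_le_one {X : Type*} {E : Fin N → Expert X} (hT : 2 ≤ T) :
    (algorithm n T (accuracy n T) E).p ≤ 1 :=
  (div_le_one (Real.sqrt_pos.2 (by linarith [one_le_accuracy_mul (n := n) hT]))).2
    (Real.one_le_sqrt.2 (one_le_accuracy_mul hT))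

theorem algorithm_p_sq {X : Type*} {E : Fin N → Expert X} (hT : 2 ≤ T) :
    (algorithm n T (accuracy n T) E).p ^ 2 = 1 / (accuracy n T * T) := by
  change (1 / √(accuracy n T * T)) ^ 2 = _
  rw [div_pow, one_pow, Real.sq_sqrt (by linarith [one_le_accuracy_mul (n := n) hT])]

theorem algorithm_radius_pos {X : Type*} {E : Fin N → Expert X} (hT : 2 ≤ T) :
    0 < (algorithm n T (accuracy n T) E).radius :=
  Real.rpow_pos_of_pos (accuracy_pos hT) _

theorem algorithm_η_pos {X : Type*} {E : Fin N → Expert X} (hT : 2 ≤ T) :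
    0 < (algorithm n T (accuracy n T) E).η := by
  have := algorithm_p_pos (n := n) (E := E) hT
  exact lt_max_of_lt_right (div_pos (pow_pos this 2) (by positivity))

theorem two_div_η_le {X : Type*} {E : Fin N → Expert X} (hT : 2 ≤ T) :
    2 / (algorithm n T (accuracy n T) E).η ≤ 3 * (accuracy n T * T) := by
  have hp := algorithm_p_pos (n := n) (E := E) hT
  have h1 : (algorithm n T (accuracy n T) E).p ^ 2 / √2 ≤ (algorithm n T (accuracy n T) E).η :=
    le_max_right _ _
  have h2 : √2 ≤ 1.5 := by
    rw [Real.sqrt_le_left (by norm_num)]; norm_num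
  have h3 := one_le_accuracy_mul (n := n) hT
  calc 2 / (algorithm n T (accuracy n T) E).η
      ≤ 2 / ((algorithm n T (accuracy n T) E).p ^ 2 / √2) := by gcongr
    _ = 2 * √2 * (accuracy n T * T) := by
        rw [algorithm_p_sq hT]
        field_simp
    _ ≤ 3 * (accuracy n T * T) := by
        gcongr
        linarith

/-- A learning rate above the query probability means that the cover is so large that the trivial
bound on the number of wrong samples suffices. -/
theorem horizon_le_of_p_lt_η {X : Type*} {E : Fin N → Expert X} (hT : 2 ≤ T)
    (h : (algorithm n T (accuracy n T) E).p < (algorithm n T (accuracy n T) E).η) :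
    (T : ℝ) ≤ Real.log N * (accuracy n T * T) := by
  have hp := algorithm_p_pos (n := n) (E := E) hT
  have hp1 := algorithm_p_le_one (n := n) (E := E) hT
  have hT0 : (0 : ℝ) < T := by exact_mod_cast (by omega : 0 < T)
  set p := (algorithm n T (accuracy n T) E).p with hpdef
  have h1 : p ^ 2 / √2 ≤ p := by
    have h2 : (1 : ℝ) ≤ √2 := Real.one_le_sqrt.2 (by norm_num)
    calc p ^ 2 / √2 ≤ p ^ 2 / 1 := by gcongr
      _ ≤ p := by nlinarith
  have h2 : p < √(p * Real.log N / (2 * T)) := by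
    rcases lt_max_iff.1 h with h' | h'
    · exact h'
    · exact absurd h' (not_lt.2 h1)
  have h3 : p ^ 2 < p * Real.log N / (2 * T) := (Real.lt_sqrt hp.le).1 h2
  rw [lt_div_iff₀ (by positivity)] at h3
  have h4 : p * (2 * T) < Real.log N := by nlinarith
  have h5 := algorithm_p_sq (n := n) (E := E) hT
  have h6 := one_le_accuracy_mul (n := n) hT
  rw [← hpdef] at h5
  have h7 : p * (accuracy n T * T) * p = 1 := by
    calc p * (accuracy n T * T) * p = p ^ 2 * (accuracy n T * T) := by ring
      _ = 1 := by rw [h5, one_div_mul_cancel (by linarith)]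
  have h8 : 1 ≤ p * (accuracy n T * T) := by
    nlinarith [mul_pos hp (lt_of_lt_of_le one_pos h6)]
  calc (T : ℝ) ≤ 2 * T * (p * (accuracy n T * T)) := by nlinarith
    _ = p * (2 * T) * (accuracy n T * T) := by ring
    _ ≤ Real.log N * (accuracy n T * T) := by gcongr

end Parameters

/-! ### The expected number of wrong samples -/

section Mistakes

variable {X : Type*} [PseudoMetricSpace X] [MeasurableSpace X] {N : ℕ} {Ω : Type*}
  [MeasurableSpace Ω] {T : ℕ} {L μmin : ℝ} {A : Params X N} {G : Environment X N Ω T L μmin} {ω : Ω}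

theorem stateAfter_past (h : List (Outcome N)) : (stateAfter A G ω h).past = inputs G ω h := by
  induction h with
  | nil => rfl
  | cons o h ih => simp [stateAfter, nextState, inputs, ih]

theorem length_inputs (h : List (Outcome N)) : (inputs G ω h).length = h.length := by
  induction h with
  | nil => rfl
  | cons o h ih => simp [inputs, ih]

theorem totalLoss_eq_zero (i : Fin N) (h : List (Outcome N))
    (hi : ∀ (x : X) (past : List X), (x :: past) <:+ inputs G ω h →
      A.expert i past x = G.mentor x) : totalLoss A G ω i h = 0 := by
  induction h with
  | nil => rfl
  | cons o h ih =>
    have h1 : totalLoss A G ω i h = 0 := ih fun x past hx =>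
      hi x past (hx.trans (List.suffix_cons _ _))
    have h2 : lossAt A G ω h i = 0 := by
      rw [lossAt, loss, if_pos]
      rw [stateAfter_past]
      exact hi _ _ (List.suffix_refl _)
    change lossAt A G ω h i + totalLoss A G ω i h = 0
    rw [h1, h2, add_zero]

variable {n d : ℕ} {𝒞 : Set (X → Bool)} {E : Fin N → Expert X} {P : Measure Ω}
  [IsProbabilityMeasure P] {σ : ℝ}

theorem agentMean_wrongSamples_le_horizon (hN : 0 < N) (hp0 : 0 ≤ A.p) (hp1 : A.p ≤ 1) :
    agentMean A G ω (fun h => ENNReal.ofReal (wrongSamples A G ω h)) T [] ≤ ENNReal.ofReal T := by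
  rw [← agentMean_const (A := A) (G := G) (ω := ω) hN hp0 hp1 (ENNReal.ofReal T) T []]
  refine agentMean_mono T [] fun h hh => ENNReal.ofReal_le_ofReal ?_
  have := wrongSamples_le_length (A := A) (G := G) (ω := ω) h
  rwa [hh, List.length_nil, zero_add] at this

/-- The bound on the expected number of wrong samples in both cases. The majorant `g` is measurable
even when the expectation over the agent's choices is not a measurable function of `ω`, as may
happen with a non-measurable mentor. -/
theorem exists_majorant_wrongSamples (hT : 2 ≤ T) (hd : 1 ≤ d) (hσ : 0 < σ) (hmentor : G.mentor ∈ 𝒞)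
    (hcase : SmoothVCCase P 𝒞 d σ (accuracy n T) E G ∨ (LittlestoneCase T 𝒞 d E ∧ σ = 1)) :
    0 < N ∧ σ ≤ 1 ∧ ∃ g : Ω → ℝ≥0∞, Measurable g ∧
      (∀ ω, agentMean (algorithm n T (accuracy n T) E) G ω (fun h => ENNReal.ofReal
        (wrongSamples (algorithm n T (accuracy n T) E) G ω h)) T [] ≤ g ω) ∧
      ∫⁻ ω, g ω ∂P ≤ ENNReal.ofReal (25 * (d / σ * Real.log T) * (accuracy n T * T)) := by
  set A := algorithm n T (accuracy n T) E with hA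
  have hp : 0 < A.p := algorithm_p_pos hT
  have hp1 : A.p ≤ 1 := algorithm_p_le_one hT
  have hη : 0 < A.η := algorithm_η_pos hT
  have hT0 : (0 : ℝ) < T := by exact_mod_cast (by omega : 0 < T)
  have hd1 : (1 : ℝ) ≤ d := by exact_mod_cast hd
  have hlogT := one_le_two_mul_log hT
  have hε := accuracy_pos (n := n) hT
  have hεT := one_le_accuracy_mul (n := n) hT
  set a := accuracy n T * T with ha
  obtain ⟨hN, hσ1, hlogN⟩ : 0 < N ∧ σ ≤ 1 ∧ Real.log N ≤ 7 * (d * Real.log T) := by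
    rcases hcase with ⟨-, -, U, hU, hG, Q, hQ, hNle, -⟩ | ⟨⟨hLit, hcov, hNle⟩, rfl⟩
    · obtain ⟨i, -⟩ := hQ.2 _ hmentor
      exact ⟨i.pos, hG.le_one hσ (by omega), log_card_le_of_smooth hT i.pos hNle⟩
    · obtain ⟨tree, -⟩ := hLit.1
      obtain ⟨i, -⟩ := hcov _ hmentor (List.replicate T (tree [])) (by simp)
      exact ⟨i.pos, le_rfl, log_card_le_of_littlestone hT hd i.pos hNle⟩
  refine ⟨hN, hσ1, ?_⟩
  have hlogN0 : 0 ≤ Real.log N := Real.log_natCast_nonneg N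
  have hdσ : (d : ℝ) ≤ d / σ := le_div_self (by linarith) hσ hσ1
  have hdlog : d * Real.log T * a ≤ d / σ * Real.log T * a := by
    have : 0 ≤ Real.log T := by linarith
    gcongr
  rcases le_or_gt A.η A.p with hηp | hηp
  · have hmain : 2 / A.η * Real.log N ≤ 21 * (d / σ * Real.log T) * a := by
      calc 2 / A.η * Real.log N ≤ 3 * a * (7 * (d * Real.log T)) := by
            gcongr
            exact two_div_η_le hT
        _ = 21 * (d * Real.log T * a) := by ring
        _ ≤ 21 * (d / σ * Real.log T * a) := by gcongr
        _ = _ := by ring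
    have hpos : 0 ≤ d / σ * Real.log T * a := by
      have : 0 ≤ Real.log T := by linarith
      positivity
    rcases hcase with ⟨-, hm, U, hU, hG, Q, hQ, -, hE⟩ | ⟨⟨-, hcov, -⟩, rfl⟩
    · obtain ⟨i, hi⟩ := hQ.2 _ hmentor
      obtain ⟨h1, h2⟩ := lintegral_agentMean_totalLoss_le (A := A) hσ hN hp.le hp1 hE hQ.1
        (hm _ hmentor) i hi hG
      refine ⟨fun ω => ENNReal.ofReal (21 * (d / σ * Real.log T) * a) + 2 *
        agentMean A G ω (fun h => ENNReal.ofReal (totalLoss A G ω i h)) T [],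
        measurable_const.add (h1.const_mul _), fun ω => ?_, ?_⟩
      · beta_reduce
        rw [agentMean_ofReal hp.le hp1 wrongSamples_nonneg,
          agentMean_ofReal hp.le hp1 (totalLoss_nonneg i), ← ENNReal.ofReal_ofNat,
          ← ENNReal.ofReal_mul (by norm_num), ← ENNReal.ofReal_add (by linarith)
            (mul_nonneg (by norm_num) (agentMeanReal_nonneg hp.le hp1 (totalLoss_nonneg i) _ _))]
        refine ENNReal.ofReal_le_ofReal
          ((agentMeanReal_wrongSamples_le i hη hηp hp1 T).trans ?_)
        gcongr
      · rw [lintegral_add_left measurable_const, lintegral_const, measure_univ, mul_one,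
          lintegral_const_mul _ h1]
        refine (add_le_add le_rfl (mul_le_mul_right h2 _)).trans ?_
        rw [← ENNReal.ofReal_ofNat, ← ENNReal.ofReal_mul (by norm_num),
          ← ENNReal.ofReal_add (by linarith) (by positivity)]
        refine ENNReal.ofReal_le_ofReal ?_
        have h3 : T * (accuracy n T / σ) ≤ 2 * (d / σ * Real.log T * a) := by
          have h4 : (1 : ℝ) ≤ d * (2 * Real.log T) := by nlinarith
          calc T * (accuracy n T / σ) = a / σ * 1 := by rw [ha]; ring
            _ ≤ a / σ * (d * (2 * Real.log T)) := by gcongr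
            _ = _ := by ring
        linarith
    · refine ⟨fun _ => ENNReal.ofReal (21 * (d / 1 * Real.log T) * a), measurable_const,
        fun ω => ?_, ?_⟩
      · rw [agentMean_ofReal hp.le hp1 wrongSamples_nonneg]
        refine ENNReal.ofReal_le_ofReal (le_trans ?_ hmain)
        refine agentMeanReal_wrongSamples_le_of_realizable hN hη hηp hp1 T fun h hh => ?_
        obtain ⟨i, hi⟩ := hcov _ hmentor (inputs G ω h) (by rw [length_inputs, hh])
        exact ⟨i, totalLoss_eq_zero i h hi⟩
      · rw [lintegral_const, measure_univ, mul_one]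
        exact ENNReal.ofReal_le_ofReal (by linarith)
  · refine ⟨fun _ => ENNReal.ofReal T, measurable_const,
      fun ω => agentMean_wrongSamples_le_horizon hN hp.le hp1, ?_⟩
    rw [lintegral_const, measure_univ, mul_one]
    refine ENNReal.ofReal_le_ofReal ((horizon_le_of_p_lt_η hT hηp).trans ?_)
    calc Real.log N * a ≤ 7 * (d * Real.log T) * a := by gcongr
      _ = 7 * (d * Real.log T * a) := by ring
      _ ≤ 7 * (d / σ * Real.log T * a) := by gcongr
      _ ≤ 25 * (d / σ * Real.log T) * a := by
        have : 0 ≤ d / σ * Real.log T * a := by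
          have : 0 ≤ Real.log T := by linarith
          positivity
        linarith

end Mistakes


/-! ### The bounds for a fixed horizon -/

section Bounds

/-- Only the positive part of `f` matters. Nothing is assumed on the measurability of `f` in `ω`,
since the integral of a majorant is bounded. -/
theorem expectation_le_of_le_wrongSamples {X : Type*} [PseudoMetricSpace X] [MeasurableSpace X]
    {N : ℕ} {Ω : Type*} [MeasurableSpace Ω] {T : ℕ} {L μmin : ℝ} {A : Params X N}
    {G : Environment X N Ω T L μmin} {P : Measure Ω} {g : Ω → ℝ≥0∞} {c b : ℝ}
    (hc : 0 ≤ c) (hb : 0 ≤ b) (hg : Measurable g)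
    (hle : ∀ ω, agentMean A G ω (fun h => ENNReal.ofReal (wrongSamples A G ω h)) T [] ≤ g ω)
    (hgb : ∫⁻ ω, g ω ∂P ≤ ENNReal.ofReal b) {f : Ω → List (Outcome N) → EReal}
    (hf : ∀ ω h, h.length ≤ T → f ω h ≤ ((c * wrongSamples A G ω h : ℝ) : EReal)) :
    expectation A G P f ≤ ((c * b : ℝ) : EReal) := by
  have h1 : expectNN A G P (fun ω h => (f ω h).toENNReal) ≤ ENNReal.ofReal (c * b) := by
    calc expectNN A G P (fun ω h => (f ω h).toENNReal)
        ≤ ∫⁻ ω, ENNReal.ofReal c * g ω ∂P := by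
          refine lintegral_mono fun ω => ?_
          refine le_trans (agentMean_mono T [] fun h hh => ?_)
            ((agentMean_const_mul _ _ T []).le.trans (mul_le_mul_right (hle ω) _))
          have h2 := EReal.toENNReal_le_toENNReal (hf ω h (by simpa using hh.le))
          rwa [EReal.real_coe_toENNReal, ENNReal.ofReal_mul hc] at h2
      _ = ENNReal.ofReal c * ∫⁻ ω, g ω ∂P := lintegral_const_mul _ hg
      _ ≤ ENNReal.ofReal c * ENNReal.ofReal b := mul_le_mul_right hgb _
      _ = ENNReal.ofReal (c * b) := (ENNReal.ofReal_mul hc).symm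
  calc expectation A G P f ≤ (expectNN A G P (fun ω h => (f ω h).toENNReal) : EReal) - 0 :=
        EReal.sub_le_sub le_rfl (EReal.coe_ennreal_nonneg _)
    _ = (expectNN A G P (fun ω h => (f ω h).toENNReal) : EReal) := sub_zero _
    _ ≤ (ENNReal.ofReal (c * b) : EReal) := EReal.coe_ennreal_le_coe_ennreal_iff.2 h1
    _ = ((c * b : ℝ) : EReal) := by
        rw [EReal.coe_ennreal_ofReal, max_eq_left (mul_nonneg hc hb)]

variable {n : ℕ} {X : Set (EuclideanSpace ℝ (Fin n))} {N : ℕ} {Ω : Type*} [MeasurableSpace Ω]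
  {T d : ℕ} {L μmin σ : ℝ} {G : Environment X N Ω T L μmin} {𝒞 : Set (X → Bool)}
  {E : Fin N → Expert X} {P : Measure Ω} [IsProbabilityMeasure P]

theorem expectation_addRegret_le (hn : 1 ≤ n) (hT : 2 ≤ T) (hd : 1 ≤ d) (hσ : 0 < σ) (hL : 0 < L)
    (hmentor : G.mentor ∈ 𝒞)
    (hcase : SmoothVCCase P 𝒞 d σ (accuracy n T) E G ∨ (LittlestoneCase T 𝒞 d E ∧ σ = 1)) :
    expectation (algorithm n T (accuracy n T) E) G P
        (fun ω h => ((addRegret (algorithm n T (accuracy n T) E) G ω h : ℝ) : EReal)) ≤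
      ((25 * (d * L / σ) * (T : ℝ) ^ (-1 / (2 * n + 1) : ℝ) * Real.log T : ℝ) : EReal) := by
  obtain ⟨-, -, g, hg, hle, hgb⟩ := exists_majorant_wrongSamples (n := n) hT hd hσ hmentor hcase
  have hr := algorithm_radius_pos (n := n) (E := E) hT
  have hlogT := one_le_two_mul_log hT
  have hεT := one_le_accuracy_mul (n := n) hT
  have hb : 0 ≤ 25 * (d / σ * Real.log T) * (accuracy n T * T) := by
    have : 0 ≤ Real.log T := by linarith
    positivity
  refine (expectation_le_of_le_wrongSamples (by positivity : 0 ≤ L *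
    (algorithm n T (accuracy n T) E).radius) hb hg hle hgb fun ω h hh =>
      EReal.coe_le_coe (addRegret_le hL.le hr.le h hh)).trans (EReal.coe_le_coe (le_of_eq ?_))
  rw [← accuracy_mul_mul_rpow hn hT]
  change L * accuracy n T ^ (1 / (n : ℝ)) * _ = _
  ring

theorem expectation_mulRegret_le (hn : 1 ≤ n) (hT : 2 ≤ T) (hd : 1 ≤ d) (hσ : 0 < σ) (hL : 0 < L)
    (hμ : 0 < μmin) (hmentor : G.mentor ∈ 𝒞)
    (hcase : SmoothVCCase P 𝒞 d σ (accuracy n T) E G ∨ (LittlestoneCase T 𝒞 d E ∧ σ = 1))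
    (hacc : accuracy n T ≤ (μmin / (2 * L)) ^ n) :
    expectation (algorithm n T (accuracy n T) E) G P
        (mulRegret (algorithm n T (accuracy n T) E) G) ≤
      ((50 * (d * L / (σ * μmin)) * (T : ℝ) ^ (-1 / (2 * n + 1) : ℝ) * Real.log T : ℝ)
        : EReal) := by
  obtain ⟨-, -, g, hg, hle, hgb⟩ := exists_majorant_wrongSamples (n := n) hT hd hσ hmentor hcase
  have hr := algorithm_radius_pos (n := n) (E := E) hT
  have hlogT := one_le_two_mul_log hT
  have hεT := one_le_accuracy_mul (n := n) hT
  have hb : 0 ≤ 25 * (d / σ * Real.log T) * (accuracy n T * T) := by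
    have : 0 ≤ Real.log T := by linarith
    positivity
  have hLr : L * (algorithm n T (accuracy n T) E).radius ≤ μmin / 2 := by
    have h1 : (algorithm n T (accuracy n T) E).radius ≤ μmin / (2 * L) := by
      refine le_of_pow_le_pow_left₀ (n := n) (by omega) (by positivity) ?_
      exact (accuracy_rpow_pow hn hT).le.trans hacc
    calc L * (algorithm n T (accuracy n T) E).radius ≤ L * (μmin / (2 * L)) := by gcongr
      _ = μmin / 2 := by field_simp
  refine (expectation_le_of_le_wrongSamples (by positivity : 0 ≤ 2 * L *
    (algorithm n T (accuracy n T) E).radius / μmin) hb hg hle hgb fun ω h hh =>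
      mulRegret_le hL.le hr.le hμ hLr h hh).trans (EReal.coe_le_coe (le_of_eq ?_))
  rw [← accuracy_mul_mul_rpow hn hT]
  change 2 * L * accuracy n T ^ (1 / (n : ℝ)) / μmin * _ = _
  field_simp
  ring

theorem expectNN_numQueries_le (hn : 1 ≤ n) (hT : 2 ≤ T) (hd : 1 ≤ d) (hσ : 0 < σ)
    (hmentor : G.mentor ∈ 𝒞)
    (hcase : SmoothVCCase P 𝒞 d σ (accuracy n T) E G ∨ (LittlestoneCase T 𝒞 d E ∧ σ = 1)) :
    expectNN (algorithm n T (accuracy n T) E) G P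
        (fun ω h => (numQueries (algorithm n T (accuracy n T) E) G ω h : ℝ≥0∞)) ≤
      ENNReal.ofReal ((50 + 4 * (4 * n) ^ n) * (T : ℝ) ^ ((4 * n + 1) / (4 * n + 2) : ℝ)) *
        (ENNReal.ofReal (d / σ * Real.log T) +
          expectNN (algorithm n T (accuracy n T) E) G P (diamPow n G)) := by
  obtain ⟨hN, hσ1, g, hg, hle, hgb⟩ :=
    exists_majorant_wrongSamples (n := n) hT hd hσ hmentor hcase
  have hr := algorithm_radius_pos (n := n) (E := E) hT
  have hp := algorithm_p_pos (n := n) (E := E) hT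
  have hp1 := algorithm_p_le_one (n := n) (E := E) hT
  have hrn : (algorithm n T (accuracy n T) E).radius ^ n = accuracy n T := accuracy_rpow_pow hn hT
  have hpT : T * (algorithm n T (accuracy n T) E).p =
      (T : ℝ) ^ ((4 * n + 1) / (4 * n + 2) : ℝ) := mul_queryProb hT
  set A := algorithm n T (accuracy n T) E with hA
  have hε := accuracy_pos (n := n) hT
  have hεinv := inv_accuracy_le (n := n) hT
  have hεT := accuracy_mul_le hn hT
  have hεT1 := one_le_accuracy_mul (n := n) hT
  set B := (T : ℝ) ^ ((4 * n + 1) / (4 * n + 2) : ℝ) with hB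
  set K : ℝ := (4 * n) ^ n with hK
  have hK0 : 0 ≤ K := by positivity
  have hB0 : 0 ≤ B := by positivity
  have hlogT := one_le_two_mul_log hT
  set D : ℝ := d / σ * Real.log T with hD
  have hD1 : 1 ≤ 2 * D := by
    have h1 : (1 : ℝ) ≤ d / σ := by
      rw [le_div_iff₀ hσ, one_mul]
      exact hσ1.trans (by exact_mod_cast hd)
    rw [hD]
    nlinarith
  have hpath : ∀ ω (h : List (Outcome N)), (numQueries A G ω h : ℝ≥0∞) ≤
      ENNReal.ofReal (hedgeQueries h) + ENNReal.ofReal (wrongSamples A G ω h) +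
        (ENNReal.ofReal (2 * K) + ENNReal.ofReal (2 * K / accuracy n T) * diamPow n G ω h) := by
    intro ω h
    have hdiam : 0 ≤ Metric.diam {x | x ∈ inputs G ω h} ^ n := pow_nonneg Metric.diam_nonneg n
    rw [diamPow, ← ENNReal.ofReal_mul (by positivity),
      ← ENNReal.ofReal_add (hedgeQueries_nonneg h) (wrongSamples_nonneg h),
      ← ENNReal.ofReal_add (by positivity) (by positivity),
      ← ENNReal.ofReal_add (add_nonneg (hedgeQueries_nonneg h) (wrongSamples_nonneg h))
        (by positivity), ← ENNReal.ofReal_natCast]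
    refine ENNReal.ofReal_le_ofReal ((numQueries_le hn hr h).trans (le_of_eq ?_))
    rw [hrn]
    ring
  -- For fixed `ω` the expectations over the agent's choices are finite sums. The integral over `ω`
  -- is additive below although `diamPow` need not be measurable, because the other summands are.
  have hω : ∀ ω, agentMean A G ω (fun h => (numQueries A G ω h : ℝ≥0∞)) T [] ≤
      (ENNReal.ofReal B + g ω + ENNReal.ofReal (2 * K)) +
        ENNReal.ofReal (2 * K / accuracy n T) * agentMean A G ω (diamPow n G ω) T [] := by
    intro ω
    refine (agentMean_mono T [] fun h _ => hpath ω h).trans ?_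
    rw [agentMean_add, agentMean_add, agentMean_add, agentMean_const hN hp.le hp1,
      agentMean_const_mul, ← add_assoc]
    have h1 : agentMean A G ω (fun h => ENNReal.ofReal (hedgeQueries h)) T [] =
        ENNReal.ofReal B := by
      rw [agentMean_ofReal hp.le hp1 hedgeQueries_nonneg, agentMeanReal_hedgeQueries hN, hpT]
      simp [hedgeQueries, historySum]
    rw [h1]
    gcongr
    exact hle ω
  have hmeas : Measurable fun ω => ENNReal.ofReal B + g ω + ENNReal.ofReal (2 * K) :=
    (measurable_const.add hg).add measurable_const
  calc expectNN A G P (fun ω h => (numQueries A G ω h : ℝ≥0∞))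
      ≤ ∫⁻ ω, ((ENNReal.ofReal B + g ω + ENNReal.ofReal (2 * K)) +
        ENNReal.ofReal (2 * K / accuracy n T) * agentMean A G ω (diamPow n G ω) T []) ∂P :=
        lintegral_mono hω
    _ = ENNReal.ofReal B + ∫⁻ ω, g ω ∂P + ENNReal.ofReal (2 * K) +
        ENNReal.ofReal (2 * K / accuracy n T) * expectNN A G P (diamPow n G) := by
        rw [lintegral_add_left hmeas, lintegral_add_right _ measurable_const,
          lintegral_add_left measurable_const, lintegral_const_mul' _ _ ENNReal.ofReal_ne_top]
        simp [expectNN]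
    _ ≤ ENNReal.ofReal B + ENNReal.ofReal (25 * D * (accuracy n T * T)) + ENNReal.ofReal (2 * K) +
        ENNReal.ofReal (2 * K / accuracy n T) * expectNN A G P (diamPow n G) := by gcongr
    _ ≤ ENNReal.ofReal ((50 + 4 * K) * B * D) +
        ENNReal.ofReal ((50 + 4 * K) * B) * expectNN A G P (diamPow n G) := by
        rw [← ENNReal.ofReal_add hB0 (by nlinarith), ← ENNReal.ofReal_add (by nlinarith)
          (by positivity)]
        have hD0 : 0 ≤ D := by linarith
        have hB1 : 1 ≤ B := hεT1.trans hεT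
        have hBD : 1 ≤ B * (2 * D) := by nlinarith
        gcongr
        · have h1 : B ≤ B * (2 * D) := le_mul_of_one_le_right hB0 hD1
          have h2 : 25 * D * (accuracy n T * T) ≤ 25 * D * B := by gcongr
          have h3 : 2 * K ≤ 2 * K * (B * (2 * D)) := le_mul_of_one_le_right (by positivity) hBD
          have h4 : 0 ≤ B * D := mul_nonneg hB0 hD0
          linarith
        · calc 2 * K / accuracy n T = 2 * K * (1 / accuracy n T) := by ring
            _ ≤ 2 * K * B := by gcongr
            _ ≤ (50 + 4 * K) * B := by
              have := mul_nonneg hK0 hB0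
              linarith
    _ = _ := by
        rw [mul_add, ← ENNReal.ofReal_mul (by positivity)]

end Bounds

/-! ### Large horizons -/

open Filter Topology

theorem tendsto_rpow_mul_log {a : ℝ} (ha : 0 < a) :
    Tendsto (fun T : ℕ => (T : ℝ) ^ (-a) * Real.log T) atTop (𝓝 0) := by
  have h1 := (isLittleO_log_rpow_atTop ha).tendsto_div_nhds_zero.comp tendsto_natCast_atTop_atTop
  refine h1.congr fun T => ?_
  simp only [Function.comp]
  rw [Real.rpow_neg (by positivity), div_eq_inv_mul]

theorem eventually_mul_rpow_mul_log_le {n : ℕ} (c : ℝ) {δ : ℝ} (hδ : 0 < δ) :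
    ∀ᶠ T : ℕ in atTop, c * (T : ℝ) ^ (-1 / (2 * n + 1) : ℝ) * Real.log T ≤ δ := by
  have h1 := (tendsto_rpow_mul_log (a := 1 / (2 * n + 1)) (by positivity)).const_mul c
  rw [mul_zero] at h1
  filter_upwards [h1.eventually_le_const hδ] with T hT
  rwa [mul_assoc, neg_div]

theorem eventually_accuracy_le {n : ℕ} (hn : 1 ≤ n) {c : ℝ} (hc : 0 < c) :
    ∀ᶠ T : ℕ in atTop, accuracy n T ≤ c := by
  have hn0 : (0 : ℝ) < n := by exact_mod_cast hn
  have h1 : Tendsto (fun T : ℕ => (T : ℝ) ^ (-((2 * n : ℝ) / (2 * n + 1)))) atTop (𝓝 0) :=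
    (tendsto_rpow_neg_atTop (by positivity)).comp tendsto_natCast_atTop_atTop
  filter_upwards [h1.eventually_le_const hc] with T hT
  rwa [accuracy, neg_div]

theorem eventually_query_bound_le {n : ℕ} (c a K : ℝ) {δ : ℝ} (hδ : 0 < δ) :
    ∀ᶠ T : ℕ in atTop,
      c * (T : ℝ) ^ ((4 * n + 1) / (4 * n + 2) : ℝ) * (a * Real.log T + K) ≤ δ * T := by
  have h1 := (tendsto_rpow_mul_log (a := 1 / (4 * n + 2)) (by positivity)).const_mul (c * a)
  have h2 : Tendsto (fun T : ℕ => c * K * (T : ℝ) ^ (-(1 / (4 * n + 2) : ℝ))) atTop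
      (𝓝 (c * K * 0)) :=
    ((tendsto_rpow_neg_atTop (by positivity)).comp tendsto_natCast_atTop_atTop).const_mul _
  have h3 := h1.add h2
  simp only [mul_zero, add_zero] at h3
  filter_upwards [h3.eventually_le_const hδ, eventually_ge_atTop 1] with T hT hT1
  have hT0 : (0 : ℝ) < T := by exact_mod_cast hT1
  have h4 : (T : ℝ) ^ ((4 * n + 1) / (4 * n + 2) : ℝ) = T ^ (-(1 / (4 * n + 2) : ℝ)) * T := by
    rw [← Real.rpow_add_one hT0.ne']
    congr 1
    field_simp
    ring
  rw [h4]
  calc _ = (c * a * (T ^ (-(1 / (4 * n + 2) : ℝ)) * Real.log T) +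
        c * K * (T : ℝ) ^ (-(1 / (4 * n + 2) : ℝ))) * T := by ring
    _ ≤ δ * T := by gcongr

end AskForHelp

theorem mainTheorem1 (n : ℕ) (hn : 1 ≤ n) :
    -- covers of the sizes that the algorithm asks for exist
    (∀ (X : Set (EuclideanSpace ℝ (Fin n))) (𝒞 : Set (X → Bool)) (d : ℕ), 1 ≤ d →
      HasVCDim 𝒞 d → (∀ π ∈ 𝒞, Measurable π) →
      ∀ (U : Measure X), IsProbabilityMeasure U → ∀ T : ℕ, 1 ≤ T →
        ∃ (N : ℕ) (Q : Fin N → X → Bool), (N : ℝ) ≤ (41 / accuracy n T) ^ d ∧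
          IsSmoothCover U (accuracy n T) 𝒞 Q) ∧
    (∀ (X : Set (EuclideanSpace ℝ (Fin n))) (𝒞 : Set (X → Bool)) (d : ℕ), 1 ≤ d →
      HasLittlestoneDim 𝒞 d → ∀ T : ℕ, d ≤ T →
        ∃ (N : ℕ) (E : Fin N → Expert X), (N : ℝ) ≤ (Real.exp 1 * T / d) ^ d ∧
          IsAdversarialCover T 𝒞 E) ∧
    -- with any such cover, the algorithm satisfies the bounds
    (∃ C : ℝ, 0 < C ∧
      ∀ (T : ℕ), 2 ≤ T → ∀ (d : ℕ), 1 ≤ d → ∀ (σ L μmin : ℝ), 0 < σ → 0 < L → 0 < μmin →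
      ∀ (X : Set (EuclideanSpace ℝ (Fin n))) (𝒞 : Set (X → Bool))
        (N : ℕ) (E : Fin N → Expert X)
        (Ω : Type*) [MeasurableSpace Ω] (P : Measure Ω) [IsProbabilityMeasure P]
        (G : Environment X N Ω T L μmin),
      G.mentor ∈ 𝒞 →
      (SmoothVCCase P 𝒞 d σ (accuracy n T) E G ∨
        (LittlestoneCase T 𝒞 d E ∧ σ = 1)) →
      ((accuracy n T ≤ (μmin / (2 * L)) ^ n →
        expectation (algorithm n T (accuracy n T) E) G P
            (mulRegret (algorithm n T (accuracy n T) E) G) ≤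
          ((C * (d * L / (σ * μmin)) * (T : ℝ) ^ (-1 / (2 * n + 1) : ℝ) * Real.log T : ℝ)
            : EReal)) ∧
      expectation (algorithm n T (accuracy n T) E) G P
          (fun ω h => ((addRegret
            (algorithm n T (accuracy n T) E) G ω h : ℝ) : EReal)) ≤
        ((C * (d * L / σ) * (T : ℝ) ^ (-1 / (2 * n + 1) : ℝ) * Real.log T : ℝ) : EReal) ∧
      expectNN (algorithm n T (accuracy n T) E) G P
          (fun ω h => (numQueries
            (algorithm n T (accuracy n T) E) G ω h : ℝ≥0∞)) ≤
        ENNReal.ofReal (C * (T : ℝ) ^ ((4 * n + 1) / (4 * n + 2) : ℝ)) *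
          (ENNReal.ofReal (d / σ * Real.log T) +
            expectNN (algorithm n T (accuracy n T) E) G P
              (diamPow n G)))) ∧
    -- hence vanishing regret and a sublinear number of queries, uniformly
    (∀ (d : ℕ), 1 ≤ d → ∀ (σ L μmin K δ : ℝ), 0 < σ → 0 < L → 0 < μmin → 0 < δ →
      ∃ T₀ : ℕ, ∀ T : ℕ, T₀ ≤ T →
      ∀ (X : Set (EuclideanSpace ℝ (Fin n))) (𝒞 : Set (X → Bool))
        (N : ℕ) (E : Fin N → Expert X)
        (Ω : Type*) [MeasurableSpace Ω] (P : Measure Ω) [IsProbabilityMeasure P]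
        (G : Environment X N Ω T L μmin),
      G.mentor ∈ 𝒞 →
      (SmoothVCCase P 𝒞 d σ (accuracy n T) E G ∨
        (LittlestoneCase T 𝒞 d E ∧ σ = 1)) →
      expectation (algorithm n T (accuracy n T) E) G P
          (mulRegret (algorithm n T (accuracy n T) E) G) ≤ δ ∧
      expectation (algorithm n T (accuracy n T) E) G P
          (fun ω h => ((addRegret
            (algorithm n T (accuracy n T) E) G ω h : ℝ) : EReal)) ≤ δ ∧
      (expectNN (algorithm n T (accuracy n T) E) G P
          (diamPow n G) ≤ ENNReal.ofReal K →
        expectNN (algorithm n T (accuracy n T) E) G P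
          (fun ω h => (numQueries
            (algorithm n T (accuracy n T) E) G ω h : ℝ≥0∞)) ≤
          ENNReal.ofReal (δ * T))) := by
  refine ⟨?_, ?_, ⟨50 + 4 * (4 * n) ^ n, by positivity, ?_⟩, ?_⟩
  · intro X 𝒞 d hd hVC hm U _ T hT
    exact exists_smoothCover hd hVC (Real.rpow_pos_of_pos (by exact_mod_cast hT) _)
      (accuracy_le_one hT) hm
  · intro X 𝒞 d hd hLit T hT
    exact exists_adversarialCover hd hLit hT
  · intro T hT d hd σ L μmin hσ hL hμ X 𝒞 N E Ω _ P _ G hmentor hcase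
    have hlog : 0 ≤ Real.log T := by linarith [one_le_two_mul_log hT]
    have hK : (0 : ℝ) ≤ 4 * (4 * n) ^ n := by positivity
    refine ⟨fun hacc => ?_, ?_, expectNN_numQueries_le hn hT hd hσ hmentor hcase⟩
    · refine (expectation_mulRegret_le hn hT hd hσ hL hμ hmentor hcase hacc).trans
        (EReal.coe_le_coe ?_)
      gcongr
      linarith
    · refine (expectation_addRegret_le hn hT hd hσ hL hmentor hcase).trans (EReal.coe_le_coe ?_)
      gcongr
      linarith
  · intro d hd σ L μmin K δ hσ hL hμ hδ
    obtain ⟨T₀, hT₀⟩ := Filter.eventually_atTop.1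
      ((((Filter.eventually_ge_atTop 2).and
        (eventually_mul_rpow_mul_log_le (n := n) (50 * (d * L / (σ * μmin))) hδ)).and
        (eventually_mul_rpow_mul_log_le (n := n) (25 * (d * L / σ)) hδ)).and
        ((eventually_accuracy_le hn (c := (μmin / (2 * L)) ^ n) (by positivity)).and
        (eventually_query_bound_le (n := n) (50 + 4 * (4 * n) ^ n) (d / σ) (max K 0) hδ)))
    refine ⟨T₀, fun T hT X 𝒞 N E Ω _ P _ G hmentor hcase => ?_⟩
    obtain ⟨⟨⟨hT2, hmul⟩, hadd⟩, hacc, hquery⟩ := hT₀ T hT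
    have hlog : 0 ≤ Real.log T := by linarith [one_le_two_mul_log hT2]
    refine ⟨?_, ?_, fun hdiam => ?_⟩
    · exact (expectation_mulRegret_le hn hT2 hd hσ hL hμ hmentor hcase hacc).trans
        (EReal.coe_le_coe hmul)
    · exact (expectation_addRegret_le hn hT2 hd hσ hL hmentor hcase).trans (EReal.coe_le_coe hadd)
    · refine (expectNN_numQueries_le hn hT2 hd hσ hmentor hcase).trans ?_
      refine le_trans ?_ (ENNReal.ofReal_le_ofReal hquery)
      rw [ENNReal.ofReal_mul (p := (50 + 4 * (4 * n) ^ n) * _) (by positivity),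
        ENNReal.ofReal_add (by positivity) (le_max_right _ _)]
      gcongr
      exact hdiam.trans (ENNReal.ofReal_le_ofReal (le_max_left _ _))
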